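/- Let $q\ge 2$ be an integer, $\mathcal Q=\{0,1,\dots,q-1\}$ with addition $\oplus_q$ and subtraction $\ominus_q$ modulo $q$, and let $\mathcal Y_3$ be a finite set. A memoryless three-user multiaccess/degraded-broadcast (MA/DB) two-way channel is given by a transition probability $P_{Y_3|X_1,X_2,X_3}$ from $\mathcal Q^3$ to $\mathcal Y_3$ and two probability distributions $P_{Z_1},P_{Z_2}$ on $\mathcal Q$. At each time $i$, given the current inputs $X_{1,i},X_{2,i},X_{3,i}\in\mathcal Q$ of users 1, 2, 3, and independently of everything in the past, user 3 receives $Y_{3,i}\sim P_{Y_3|X_1,X_2,X_3}(\cdot|X_{1,i},X_{2,i},X_{3,i})$, user 1 receives $Y_{1,i}=X_{1,i}\oplus_q X_{3,i}\oplus_q Z_{1,i}$ and user 2 receives $Y_{2,i}=X_{2,i}\oplus_q X_{3,i}\oplus_q Z_{1,i}\oplus_q Z_{2,i}$, where $Z_{1,i}\sim P_{Z_1}$ and $Z_{2,i}\sim P_{Z_2}$ are independent of each other and of $Y_{3,i}$; that is, $$P(y_1,y_2,y_3|x_1,x_2,x_3)=P_{Y_3|X_1,X_2,X_3}(y_3|x_1,x_2,x_3)\,P_{Z_1}(y_1\ominus_q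 x_1\ominus_q x_3)\,P_{Z_2}(y_2\ominus_q x_2\ominus_q y_1\oplus_q x_1).$$ For rates $R_{13},R_{23},R_{31},R_{32}\ge 0$, an $(n,R_{13},R_{23},R_{31},R_{32})$ code consists of message sets $\mathcal M_{jk}=\{1,2,\dots,\lfloor 2^{nR_{jk}}\rfloor\}$ for $jk\in\{13,23,31,32\}$, encoding functions $f_{1,i},f_{2,i},f_{3,i}$ with $X_{1,i}=f_{1,i}(M_{13},Y_1^{i-1})$, $X_{2,i}=f_{2,i}(M_{23},Y_2^{i-1})$, $X_{3,i}=f_{3,i}(M_{31},M_{32},Y_3^{i-1})$ for $i=1,\dots,n$, and decoding functions $g_1,g_2,g_3$ with $\hat M_{31}=g_1(M_{13},Y_1^n)$, $\hat M_{32}=g_2(M_{23},Y_2^n)$, $(\hat M_{13},\hat M_{23})=g_3(M_{31},M_{32},Y_3^n)$. The four messages are independent, uniformly distributed on their message sets, and independent of the channel noise. The error probability $P_{\mathrm e}^{(n)}$ is the probability that at least one of the four estimates differs from the corresponding message. The quadruple $(R_{13},R_{23},R_{31},R_{32})$ is achievable if there is a sequence of $(n,R_{13},R_{23},R_{31},R_{32})$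 codes, $n=1,2,\dots$, with $\lim_{n\to\infty}P_{\mathrm e}^{(n)}=0$. For a joint distribution $P_{X_1,X_2,X_3,V}$ on $\mathcal Q^3\times\mathcal V$ with $\mathcal V$ finite, let $\mathcal R(P_{X_1,X_2,X_3,V})$ be the set of all quadruples $(R_{13},R_{23},R_{31},R_{32})$ of nonnegative reals with $$R_{13}\le I(X_1;Y_3|X_2,X_3),\quad R_{23}\le I(X_2;Y_3|X_1,X_3),\quad R_{13}+R_{23}\le I(X_1,X_2;Y_3|X_3),$$ $$R_{31}\le I(X_3;X_3\oplus_q Z_1|V),\quad R_{32}\le I(V;X_3\oplus_q Z_1\oplus_q Z_2),$$ where the mutual informations (in bits) are evaluated under $P_{X_1,X_2,X_3,V}\cdot P_{Y_3|X_1,X_2,X_3}\cdot P_{Z_1}\cdot P_{Z_2}$. Theorem. Every achievable rate quadruple of the channel belongs to $$\mathcal C_{\mathrm O}=\overline{\mathrm{co}}\Big(\bigcup_{P_{X_1,X_2,X_3,V}}\mathcal R(P_{X_1,X_2,X_3,V})\Big),$$ where the union is over all joint distributions $P_{X_1,X_2,X_3,V}$ with $|\mathcal V|\le q+1$, and $\overline{\mathrm{co}}$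 denotes the closure of the convex hull. -/

import Mathlib

/-! Finite probability: a probability mass function on a finite sample space `Ω` is an element `p` of
`stdSimplex ℝ Ω`; random variables are functions on `Ω`. All logarithms are to base 2. -/

namespace MADB

open Classical in
/-- The law of the random variable `X` under the mass function `p`. -/
noncomputable def law {Ω α : Type*} [Fintype Ω] (p : Ω → ℝ) (X : Ω → α) (a : α) : ℝ :=
  ∑ ω, if X ω = a then p ω else 0

/-- Shannon entropy `H(X)` in bits (with `0 log 0 = 0`). -/
noncomputable def entropy {Ω α : Type*} [Fintype Ω] [Fintype α] (p : Ω → ℝ) (X : Ω → α) : ℝ :=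
  -∑ a, law p X a * Real.logb 2 (law p X a)

/-- Conditional entropy `H(X|Z) = H(X,Z) - H(Z)`. -/
noncomputable def condEntropy {Ω α γ : Type*} [Fintype Ω] [Fintype α] [Fintype γ]
    (p : Ω → ℝ) (X : Ω → α) (Z : Ω → γ) : ℝ :=
  entropy p (fun ω => (X ω, Z ω)) - entropy p Z

/-- Mutual information `I(X;Y) = H(X) - H(X|Y)`. -/
noncomputable def mutualInfo {Ω α β : Type*} [Fintype Ω] [Fintype α] [Fintype β]
    (p : Ω → ℝ) (X : Ω → α) (Y : Ω → β) : ℝ :=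
  entropy p X - condEntropy p X Y

/-- Conditional mutual information `I(X;Y|Z) = H(X|Z) - H(X|Y,Z)`. -/
noncomputable def condMutualInfo {Ω α β γ : Type*} [Fintype Ω] [Fintype α] [Fintype β] [Fintype γ]
    (p : Ω → ℝ) (X : Ω → α) (Y : Ω → β) (Z : Ω → γ) : ℝ :=
  condEntropy p X Z - condEntropy p X (fun ω => (Y ω, Z ω))

/-- A memoryless three-user multiaccess/degraded-broadcast two-way channel. The alphabets of
`X₁, X₂, X₃, Y₁, Y₂, Z₁, Z₂` are `ZMod q`, the alphabet of `Y₃` is `𝒴`. -/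
structure Channel (q : ℕ) [NeZero q] (𝒴 : Type*) [Fintype 𝒴] where
  /-- `PY3 x₁ x₂ x₃ y₃ = P(Y₃ = y₃ | X₁ = x₁, X₂ = x₂, X₃ = x₃)` -/
  PY3 : ZMod q → ZMod q → ZMod q → 𝒴 → ℝ
  PZ1 : ZMod q → ℝ
  PZ2 : ZMod q → ℝ
  PY3_mem : ∀ x₁ x₂ x₃, PY3 x₁ x₂ x₃ ∈ stdSimplex ℝ 𝒴
  PZ1_mem : PZ1 ∈ stdSimplex ℝ (ZMod q)
  PZ2_mem : PZ2 ∈ stdSimplex ℝ (ZMod q)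

/-- The one-step transition probability `P(y₁, y₂, y₃ | x₁, x₂, x₃)` of the channel with
`Y₁ = X₁ + X₃ + Z₁` and `Y₂ = X₂ + X₃ + Z₁ + Z₂ = X₂ + (Y₁ - X₁) + Z₂`. -/
def Channel.transition {q : ℕ} [NeZero q] {𝒴 : Type*} [Fintype 𝒴] (W : Channel q 𝒴)
    (x₁ x₂ x₃ y₁ y₂ : ZMod q) (y₃ : 𝒴) : ℝ :=
  W.PY3 x₁ x₂ x₃ y₃ * W.PZ1 (y₁ - x₁ - x₃) * W.PZ2 (y₂ - x₂ - y₁ + x₁)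

/-- The message set `{1, 2, …, 2^{nR}}`, with `⌊2^{nR}⌋` elements. -/
abbrev Msg (n : ℕ) (R : ℝ) : Type := Fin ⌊(2 : ℝ) ^ ((n : ℝ) * R)⌋₊

/-- The symbols of `y` before time `i`. -/
def past {n : ℕ} {α : Type*} (y : Fin n → α) (i : Fin n) : Fin (i : ℕ) → α :=
  fun j => y ⟨j, j.2.trans i.2⟩

/-- An `(n, R₁₃, R₂₃, R₃₁, R₃₂)` channel code with feedback encoders and decoders. -/
structure Code (q : ℕ) (𝒴 : Type*) (n : ℕ) (R₁₃ R₂₃ R₃₁ R₃₂ : ℝ) where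
  f₁ : (i : Fin n) → Msg n R₁₃ → (Fin (i : ℕ) → ZMod q) → ZMod q
  f₂ : (i : Fin n) → Msg n R₂₃ → (Fin (i : ℕ) → ZMod q) → ZMod q
  f₃ : (i : Fin n) → Msg n R₃₁ → Msg n R₃₂ → (Fin (i : ℕ) → 𝒴) → ZMod q
  /-- estimate of `M₃₁` at user 1 -/
  g₁ : Msg n R₁₃ → (Fin n → ZMod q) → Msg n R₃₁
  /-- estimate of `M₃₂` at user 2 -/
  g₂ : Msg n R₂₃ → (Fin n → ZMod q) → Msg n R₃₂
  /-- estimate of `(M₁₃, M₂₃)` at user 3 -/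
  g₃ : Msg n R₃₁ → Msg n R₃₂ → (Fin n → 𝒴) → Msg n R₁₃ × Msg n R₂₃

section Code

variable {q : ℕ} [NeZero q] {𝒴 : Type*} [Fintype 𝒴] {n : ℕ} {R₁₃ R₂₃ R₃₁ R₃₂ : ℝ}

/-- The joint probability of the messages and the output sequences when the code is used over the
channel: the messages are independent and uniform, and the channel is memoryless. -/
noncomputable def jointProb (W : Channel q 𝒴) (c : Code q 𝒴 n R₁₃ R₂₃ R₃₁ R₃₂)
    (m₁₃ : Msg n R₁₃) (m₂₃ : Msg n R₂₃) (m₃₁ : Msg n R₃₁) (m₃₂ : Msg n R₃₂)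
    (y₁ y₂ : Fin n → ZMod q) (y₃ : Fin n → 𝒴) : ℝ :=
  (Fintype.card (Msg n R₁₃) : ℝ)⁻¹ * (Fintype.card (Msg n R₂₃) : ℝ)⁻¹ *
    (Fintype.card (Msg n R₃₁) : ℝ)⁻¹ * (Fintype.card (Msg n R₃₂) : ℝ)⁻¹ *
    ∏ i, W.transition (c.f₁ i m₁₃ (past y₁ i)) (c.f₂ i m₂₃ (past y₂ i))
      (c.f₃ i m₃₁ m₃₂ (past y₃ i)) (y₁ i) (y₂ i) (y₃ i)

/-- The probability that at least one of the four messages is decoded wrongly. -/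
noncomputable def errorProb (W : Channel q 𝒴) (c : Code q 𝒴 n R₁₃ R₂₃ R₃₁ R₃₂) : ℝ :=
  ∑ m₁₃, ∑ m₂₃, ∑ m₃₁, ∑ m₃₂, ∑ y₁, ∑ y₂, ∑ y₃,
    if (c.g₃ m₃₁ m₃₂ y₃).1 ≠ m₁₃ ∨ (c.g₃ m₃₁ m₃₂ y₃).2 ≠ m₂₃ ∨ c.g₁ m₁₃ y₁ ≠ m₃₁ ∨
        c.g₂ m₂₃ y₂ ≠ m₃₂
    then jointProb W c m₁₃ m₂₃ m₃₁ m₃₂ y₁ y₂ y₃ else 0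

/-- Achievability of a (nonnegative) rate quadruple: there is a sequence of codes, one for each
block length, whose error probability tends to zero. -/
def Achievable (W : Channel q 𝒴) (R₁₃ R₂₃ R₃₁ R₃₂ : ℝ) : Prop :=
  0 ≤ R₁₃ ∧ 0 ≤ R₂₃ ∧ 0 ≤ R₃₁ ∧ 0 ≤ R₃₂ ∧
    ∃ c : (n : ℕ) → Code q 𝒴 n R₁₃ R₂₃ R₃₁ R₃₂,
      Filter.Tendsto (fun n => errorProb W (c n)) Filter.atTop (nhds 0)

end Code

section Region

variable {q : ℕ} [NeZero q] {𝒴 𝒱 : Type*} [Fintype 𝒴] [Fintype 𝒱]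

/-- The values of `(X₁, X₂, X₃, V, Y₃, Z₁, Z₂)`. -/
structure Outcome (q : ℕ) (𝒴 𝒱 : Type*) where
  X₁ : ZMod q
  X₂ : ZMod q
  X₃ : ZMod q
  V : 𝒱
  Y₃ : 𝒴
  Z₁ : ZMod q
  Z₂ : ZMod q

/-- Outcomes are tuples. -/
def Outcome.equivProd (q : ℕ) (𝒴 𝒱 : Type*) :
    Outcome q 𝒴 𝒱 ≃ ZMod q × ZMod q × ZMod q × 𝒱 × 𝒴 × ZMod q × ZMod q where
  toFun ω := (ω.X₁, ω.X₂, ω.X₃, ω.V, ω.Y₃, ω.Z₁, ω.Z₂)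
  invFun t := ⟨t.1, t.2.1, t.2.2.1, t.2.2.2.1, t.2.2.2.2.1, t.2.2.2.2.2.1, t.2.2.2.2.2.2⟩
  left_inv _ := rfl
  right_inv _ := rfl

instance : Fintype (Outcome q 𝒴 𝒱) := Fintype.ofEquiv _ (Outcome.equivProd q 𝒴 𝒱).symm

/-- The joint law `P_{X₁,X₂,X₃,V} · P_{Y₃|X₁,X₂,X₃} · P_{Z₁} · P_{Z₂}`. -/
def Channel.outcomeProb (W : Channel q 𝒴) (P : ZMod q × ZMod q × ZMod q × 𝒱 → ℝ)
    (ω : Outcome q 𝒴 𝒱) : ℝ :=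
  P (ω.X₁, ω.X₂, ω.X₃, ω.V) * W.PY3 ω.X₁ ω.X₂ ω.X₃ ω.Y₃ * W.PZ1 ω.Z₁ * W.PZ2 ω.Z₂

/-- The set of nonnegative rate quadruples `(R₁₃, R₂₃, R₃₁, R₃₂)` that satisfy the multiple-access
and the degraded-broadcast constraints for the law `P` of `(X₁, X₂, X₃, V)`. -/
def rateRegion (W : Channel q 𝒴) (P : ZMod q × ZMod q × ZMod q × 𝒱 → ℝ) : Set (ℝ × ℝ × ℝ × ℝ) :=
  {(R₁₃, R₂₃, R₃₁, R₃₂) : ℝ × ℝ × ℝ × ℝ |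
    0 ≤ R₁₃ ∧ 0 ≤ R₂₃ ∧ 0 ≤ R₃₁ ∧ 0 ≤ R₃₂ ∧
    -- I(X₁; Y₃ | X₂, X₃)
    R₁₃ ≤ condMutualInfo (W.outcomeProb P) (·.X₁) (·.Y₃) (fun ω => (ω.X₂, ω.X₃)) ∧
    -- I(X₂; Y₃ | X₁, X₃)
    R₂₃ ≤ condMutualInfo (W.outcomeProb P) (·.X₂) (·.Y₃) (fun ω => (ω.X₁, ω.X₃)) ∧
    -- I(X₁, X₂; Y₃ | X₃)
    R₁₃ + R₂₃ ≤ condMutualInfo (W.outcomeProb P) (fun ω => (ω.X₁, ω.X₂)) (·.Y₃) (·.X₃) ∧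
    -- I(X₃; X₃ + Z₁ | V)
    R₃₁ ≤ condMutualInfo (W.outcomeProb P) (·.X₃) (fun ω => ω.X₃ + ω.Z₁) (·.V) ∧
    -- I(V; X₃ + Z₁ + Z₂)
    R₃₂ ≤ mutualInfo (W.outcomeProb P) (·.V) (fun ω => ω.X₃ + ω.Z₁ + ω.Z₂)}

/-- The outer bound: the closure of the convex hull of the union of the rate regions over all joint
laws of `(X₁, X₂, X₃, V)`, the alphabet of `V` having at most `q + 1` elements. -/
def outerBound (W : Channel q 𝒴) : Set (ℝ × ℝ × ℝ × ℝ) :=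
  closure (convexHull ℝ {R | ∃ k ≤ q + 1,
    ∃ P ∈ stdSimplex ℝ (ZMod q × ZMod q × ZMod q × Fin k), R ∈ rateRegion W P})

end Region

end MADB

/-!
Fano's inequality bounds the logarithm of the number of messages by the mutual information between
a message and the observations of its decoder, which are then enlarged until the chain rule is
exact. Given the messages, the past of `(Y₃, Z₁, Z₂)` determines the past outputs and hence all
inputs, in spite of the feedback, so the entropies of the noise cancel. For the broadcast part, the
auxiliary variable `Vᵢ` consists of all messages but `M₃₁` and the past outputs of users 1 and 2. A
uniformly distributed time index, absorbed into `V`, turns the averages over time into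
single-letter expressions.

Finally, the alphabet of `V` is reduced. Given `V = v`, the law of `X₃` and the entropy of `X₃ + Z₁`
form a vector with `q + 1` coordinates, so Carathéodory's theorem for cones leaves `q + 1` values of
`V` that preserve the law of `X₃` and `H(X₃ + Z₁ | V)`; among these representations, one does not
increase `H(X₃ + Z₁ + Z₂ | V)`. Drawing `(X₁, X₂)` from its conditional law given `X₃`,
independently of `V`, keeps the multiple-access constraints.
-/

namespace MADB

open Finset Real

section Entropy

variable {Ω α β γ δ : Type*} [Fintype Ω] {p : Ω → ℝ}

lemma nonempty_of_mem_stdSimplex (hp : p ∈ stdSimplex ℝ Ω) : Nonempty Ω := by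
  by_contra h
  rw [not_nonempty_iff] at h
  simpa using hp.2

lemma law_nonneg (hp : ∀ ω, 0 ≤ p ω) (X : Ω → α) (a : α) : 0 ≤ law p X a :=
  sum_nonneg fun ω _ => by split_ifs <;> simp [hp]

lemma le_law (hp : ∀ ω, 0 ≤ p ω) (X : Ω → α) (ω : Ω) : p ω ≤ law p X (X ω) := by
  classical
  refine le_trans (by simp) (single_le_sum (f := fun ω' => if X ω' = X ω then p ω' else 0)
    (fun ω' _ => by split_ifs <;> simp [hp]) (mem_univ ω))

lemma law_pos (hp : ∀ ω, 0 ≤ p ω) (X : Ω → α) {ω : Ω} (hω : 0 < p ω) : 0 < law p X (X ω) :=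
  hω.trans_le (le_law hp X ω)

lemma exists_pos_of_law_pos (hp : ∀ ω, 0 ≤ p ω) {X : Ω → α} {a : α} (h : 0 < law p X a) :
    ∃ ω, X ω = a ∧ 0 < p ω := by
  obtain ⟨ω, -, hω⟩ := exists_ne_zero_of_sum_ne_zero h.ne'
  classical
  have := ite_ne_right_iff.1 hω
  exact ⟨ω, this.1, (hp ω).lt_of_ne' this.2⟩

lemma sum_law_mul [Fintype α] (p : Ω → ℝ) (X : Ω → α) (F : α → ℝ) :
    ∑ a, law p X a * F a = ∑ ω, p ω * F (X ω) := by
  classical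
  simp only [law, sum_mul, ite_mul, zero_mul]
  rw [sum_comm]
  exact sum_congr rfl fun ω _ => by simp

lemma sum_law [Fintype α] (p : Ω → ℝ) (X : Ω → α) : ∑ a, law p X a = ∑ ω, p ω := by
  simpa using sum_law_mul p X fun _ => 1

lemma law_mem_stdSimplex [Fintype α] (hp : p ∈ stdSimplex ℝ Ω) (X : Ω → α) :
    law p X ∈ stdSimplex ℝ α :=
  ⟨law_nonneg hp.1 X, (sum_law p X).trans hp.2⟩

lemma sum_law_prodMk [Fintype α] (p : Ω → ℝ) (X : Ω → α) (Y : Ω → β) (b : β) :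
    ∑ a, law p (fun ω => (X ω, Y ω)) (a, b) = law p Y b := by
  classical
  simp only [law]
  rw [sum_comm]
  exact sum_congr rfl fun ω _ => by by_cases h : Y ω = b <;> simp [h, Prod.ext_iff]

lemma law_congr {X : Ω → α} {Y : Ω → β} {a : α} {b : β} (h : ∀ ω, X ω = a ↔ Y ω = b) :
    law p X a = law p Y b :=
  sum_congr rfl fun ω _ => by by_cases hb : Y ω = b <;> simp [h, hb]

lemma law_law [Fintype β] (p : Ω → ℝ) (X : Ω → β) (F : β → α) :
    law (law p X) F = law p (fun ω => F (X ω)) := by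
  classical
  ext a
  simpa [law] using sum_law_mul p X fun b => if F b = a then 1 else 0

lemma entropy_eq [Fintype α] (p : Ω → ℝ) (X : Ω → α) :
    entropy p X = -∑ ω, p ω * logb 2 (law p X (X ω)) := by
  rw [entropy, sum_law_mul p X fun a => logb 2 (law p X a)]

lemma entropy_law [Fintype α] [Fintype β] (p : Ω → ℝ) (X : Ω → β) (F : β → α) :
    entropy (law p X) F = entropy p (fun ω => F (X ω)) := by
  simp only [entropy, law_law]

lemma condEntropy_law [Fintype α] [Fintype β] [Fintype γ] (p : Ω → ℝ) (X : Ω → γ) (F : γ → α)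
    (G : γ → β) :
    condEntropy (law p X) F G = condEntropy p (fun ω => F (X ω)) (fun ω => G (X ω)) := by
  simp only [condEntropy, entropy_law]

lemma entropy_congr [Fintype α] [Fintype β] {X : Ω → α} {Y : Ω → β}
    (h : ∀ ω ω', X ω = X ω' ↔ Y ω = Y ω') : entropy p X = entropy p Y := by
  simp only [entropy_eq, law_congr fun ω' => h ω' _]

lemma condEntropy_congr [Fintype α] [Fintype β] [Fintype γ] [Fintype δ]
    {X : Ω → α} {Y : Ω → β} {Z : Ω → γ} {T : Ω → δ} (hZ : ∀ ω ω', Z ω = Z ω' ↔ T ω = T ω')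
    (h : ∀ ω ω', Z ω = Z ω' → (X ω = X ω' ↔ Y ω = Y ω')) :
    condEntropy p X Z = condEntropy p Y T := by
  rw [condEntropy, condEntropy, entropy_congr hZ, entropy_congr (Y := fun ω => (Y ω, T ω))]
  simp only [Prod.mk.injEq, ← hZ]
  exact fun ω ω' => and_congr_left (h ω ω')

lemma sum_mul_logb_le_sum_mul_logb_self {ι : Type*} [Fintype ι] {s r : ι → ℝ} (hs : ∀ i, 0 ≤ s i)
    (hr : ∀ i, 0 ≤ r i) (hsr : ∀ i, 0 < s i → 0 < r i) (hsum : ∑ i, r i ≤ ∑ i, s i) :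
    ∑ i, s i * logb 2 (r i) ≤ ∑ i, s i * logb 2 (s i) := by
  have hterm : ∀ i, s i * log (r i) - s i * log (s i) ≤ r i - s i := by
    intro i
    rcases (hs i).eq_or_lt with h0 | h0
    · simp [← h0, hr i]
    have hlog := log_le_sub_one_of_pos (div_pos (hsr i h0) h0)
    rw [log_div (hsr i h0).ne' h0.ne'] at hlog
    calc s i * log (r i) - s i * log (s i) = s i * (log (r i) - log (s i)) := by ring
      _ ≤ s i * (r i / s i - 1) := by gcongr
      _ = r i - s i := by field_simp
  have hlog : ∑ i, s i * log (r i) ≤ ∑ i, s i * log (s i) := by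
    have := sum_le_sum fun i (_ : i ∈ univ) => hterm i
    simp only [sum_sub_distrib] at this
    linarith
  simp only [logb, ← mul_div_assoc, ← sum_div]
  gcongr

lemma condEntropy_le_crossEntropy [Fintype α] [Fintype β] (hp : ∀ ω, 0 ≤ p ω) (X : Ω → α)
    (Y : Ω → β) {Q : β → α → ℝ} (hQ : ∀ b a, 0 ≤ Q b a) (hQ1 : ∀ b, ∑ a, Q b a ≤ 1)
    (hpos : ∀ ω, 0 < p ω → 0 < Q (Y ω) (X ω)) :
    condEntropy p X Y ≤ -∑ ω, p ω * logb 2 (Q (Y ω) (X ω)) := by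
  set J := law p (fun ω => (X ω, Y ω)) with hJ
  have hpos_of_J : ∀ c, 0 < J c → 0 < Q c.2 c.1 * law p Y c.2 := by
    intro c hc
    obtain ⟨ω, rfl, hω⟩ := exists_pos_of_law_pos hp hc
    exact mul_pos (hpos ω hω) (law_pos hp Y hω)
  have hsum : ∑ c : α × β, Q c.2 c.1 * law p Y c.2 ≤ ∑ c, J c := by
    rw [hJ, sum_law, ← sum_law p Y, Fintype.sum_prod_type_right]
    simp only [← sum_mul]
    exact sum_le_sum fun b _ => mul_le_of_le_one_left (law_nonneg hp Y b) (hQ1 b)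
  have hgibbs := sum_mul_logb_le_sum_mul_logb_self (law_nonneg hp _)
    (fun c : α × β => mul_nonneg (hQ c.2 c.1) (law_nonneg hp Y c.2)) hpos_of_J hsum
  rw [sum_law_mul p _ fun c : α × β => logb 2 (Q c.2 c.1 * law p Y c.2)] at hgibbs
  have hentropy : entropy p (fun ω => (X ω, Y ω)) = -∑ c, J c * logb 2 (J c) := rfl
  have hsplit : ∑ ω, p ω * logb 2 (Q (Y ω) (X ω) * law p Y (Y ω)) =
      ∑ ω, p ω * logb 2 (Q (Y ω) (X ω)) + ∑ ω, p ω * logb 2 (law p Y (Y ω)) := by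
    rw [← sum_add_distrib]
    refine sum_congr rfl fun ω _ => ?_
    rcases (hp ω).eq_or_lt with h0 | h0
    · simp [← h0]
    rw [logb_mul (hpos ω h0).ne' (law_pos hp Y h0).ne', mul_add]
  rw [condEntropy, hentropy, entropy_eq p Y]
  linarith

lemma condEntropy_eq_sum [Fintype α] [Fintype β] (hp : ∀ ω, 0 ≤ p ω) (X : Ω → α) (Y : Ω → β) :
    condEntropy p X Y =
      -∑ ω, p ω * logb 2 (law p (fun ω => (X ω, Y ω)) (X ω, Y ω) / law p Y (Y ω)) := by
  rw [condEntropy, entropy_eq, entropy_eq, neg_sub_neg, ← sum_sub_distrib, ← sum_neg_distrib]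
  refine sum_congr rfl fun ω _ => ?_
  rcases (hp ω).eq_or_lt with h0 | h0
  · simp [← h0]
  rw [logb_div (law_pos hp (fun ω => (X ω, Y ω)) h0).ne' (law_pos hp Y h0).ne']
  ring

lemma condEntropy_anti [Fintype α] [Fintype β] [Fintype γ] (hp : ∀ ω, 0 ≤ p ω) (X : Ω → α)
    {Y : Ω → β} {Z : Ω → γ} (h : Z.FactorsThrough Y) :
    condEntropy p X Y ≤ condEntropy p X Z := by
  rw [condEntropy_congr (Y := X) (T := fun ω => (Y ω, Z ω))
    (by simp only [Prod.mk.injEq]; exact fun ω ω' => (and_iff_left_of_imp (@h ω ω')).symm)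
    (by simp), condEntropy_eq_sum hp X Z]
  refine condEntropy_le_crossEntropy hp X (fun ω => (Y ω, Z ω))
    (Q := fun c a => law p (fun ω => (X ω, Z ω)) (a, c.2) / law p Z c.2)
    (fun c a => div_nonneg (law_nonneg hp _ _) (law_nonneg hp _ _)) (fun c => ?_)
    fun ω h0 => div_pos (law_pos hp (fun ω => (X ω, Z ω)) h0) (law_pos hp Z h0)
  rw [← sum_div, sum_law_prodMk]
  exact div_self_le_one _

lemma condEntropy_prodMk [Fintype α] [Fintype β] [Fintype γ] (X : Ω → α) (Y : Ω → β)
    (Z : Ω → γ) :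
    condEntropy p (fun ω => (X ω, Y ω)) Z =
      condEntropy p X Z + condEntropy p Y (fun ω => (X ω, Z ω)) := by
  have : entropy p (fun ω => ((X ω, Y ω), Z ω)) = entropy p (fun ω => (Y ω, X ω, Z ω)) :=
    entropy_congr (by simp only [Prod.mk.injEq]; grind)
  simp only [condEntropy, this]
  ring

lemma condMutualInfo_eq [Fintype α] [Fintype β] [Fintype γ] (X : Ω → α) (Y : Ω → β) (Z : Ω → γ) :
    condMutualInfo p X Y Z = condEntropy p Y Z - condEntropy p Y (fun ω => (X ω, Z ω)) := by
  have : entropy p (fun ω => (X ω, Y ω, Z ω)) = entropy p (fun ω => (Y ω, X ω, Z ω)) :=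
    entropy_congr (by simp only [Prod.mk.injEq]; grind)
  simp only [condMutualInfo, condEntropy, this]
  ring

lemma condMutualInfo_nonneg [Fintype α] [Fintype β] [Fintype γ] (hp : ∀ ω, 0 ≤ p ω)
    (X : Ω → α) (Y : Ω → β) (Z : Ω → γ) : 0 ≤ condMutualInfo p X Y Z :=
  sub_nonneg.2 (condEntropy_anti hp X fun _ _ h => (Prod.mk.inj h).2)

lemma mutualInfo_eq [Fintype α] [Fintype β] (X : Ω → α) (Y : Ω → β) :
    mutualInfo p X Y = entropy p Y - condEntropy p Y X := by
  have : entropy p (fun ω => (X ω, Y ω)) = entropy p (fun ω => (Y ω, X ω)) :=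
    entropy_congr (by simp only [Prod.mk.injEq]; grind)
  simp only [mutualInfo, condEntropy, this]
  ring

lemma condMutualInfo_law [Fintype α] [Fintype β] [Fintype γ] [Fintype δ] (p : Ω → ℝ) (X : Ω → δ)
    (F : δ → α) (G : δ → β) (H : δ → γ) :
    condMutualInfo (law p X) F G H =
      condMutualInfo p (fun ω => F (X ω)) (fun ω => G (X ω)) (fun ω => H (X ω)) := by
  simp only [condMutualInfo, condEntropy_law]

lemma entropy_of_subsingleton [Fintype α] [Subsingleton α] (hp : ∑ ω, p ω = 1) (X : Ω → α) :
    entropy p X = 0 := by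
  have : ∀ ω, law p X (X ω) = 1 := fun ω => by simp [law, Subsingleton.elim _ (X ω), hp]
  simp [entropy_eq, this]

lemma condEntropy_of_subsingleton [Fintype α] [Fintype β] [Subsingleton β] (hp : ∑ ω, p ω = 1)
    (X : Ω → α) (Y : Ω → β) : condEntropy p X Y = entropy p X := by
  rw [condEntropy, entropy_of_subsingleton hp Y, sub_zero]
  exact entropy_congr fun ω ω' => by simp [Subsingleton.elim (Y ω) (Y ω')]

lemma condEntropy_le_entropy [Fintype α] [Fintype β] (hp : p ∈ stdSimplex ℝ Ω) (X : Ω → α)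
    (Y : Ω → β) : condEntropy p X Y ≤ entropy p X := by
  rw [← condEntropy_of_subsingleton hp.2 X fun _ => ()]
  exact condEntropy_anti hp.1 X fun _ _ _ => rfl

lemma mutualInfo_nonneg [Fintype α] [Fintype β] (hp : p ∈ stdSimplex ℝ Ω) (X : Ω → α)
    (Y : Ω → β) : 0 ≤ mutualInfo p X Y :=
  sub_nonneg.2 (condEntropy_le_entropy hp X Y)

lemma entropy_le_logb_card [Fintype α] (hp : p ∈ stdSimplex ℝ Ω) (X : Ω → α) :
    entropy p X ≤ logb 2 (Fintype.card α) := by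
  have : Nonempty α := (nonempty_of_mem_stdSimplex hp).map X
  rw [← condEntropy_of_subsingleton hp.2 X fun _ => ()]
  refine (condEntropy_le_crossEntropy hp.1 X (fun _ => ())
    (Q := fun _ _ => (Fintype.card α : ℝ)⁻¹) (fun _ _ => by positivity) (fun _ => by simp)
    fun _ _ => by positivity).trans_eq ?_
  simp [logb_inv, ← sum_mul, hp.2]

/-- The probability of the event `S`. -/
noncomputable def prob (p : Ω → ℝ) (S : Set Ω) : ℝ := ∑ ω, S.indicator p ω

lemma prob_mono (hp : ∀ ω, 0 ≤ p ω) {S T : Set Ω} (h : S ⊆ T) : prob p S ≤ prob p T :=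
  sum_le_sum fun _ _ => Set.indicator_le_indicator_of_subset h hp _

lemma prob_nonneg (hp : ∀ ω, 0 ≤ p ω) (S : Set Ω) : 0 ≤ prob p S :=
  sum_nonneg fun ω _ => Set.indicator_nonneg (fun ω _ => hp ω) ω

lemma prob_le_one (hp : p ∈ stdSimplex ℝ Ω) (S : Set Ω) : prob p S ≤ 1 :=
  hp.2 ▸ sum_le_sum fun ω _ => Set.indicator_le_self' (fun _ _ => hp.1 _) ω

/-- Fano's inequality. -/
lemma condEntropy_le_prob_ne [Fintype α] [Fintype β] (hp : p ∈ stdSimplex ℝ Ω) (X : Ω → α)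
    (Y : Ω → β) (g : β → α) :
    condEntropy p X Y ≤ 1 + prob p {ω | X ω ≠ g (Y ω)} * logb 2 (Fintype.card α) := by
  classical
  have : Nonempty α := (nonempty_of_mem_stdSimplex hp).map X
  have hcard : (0 : ℝ) < Fintype.card α := by exact_mod_cast Fintype.card_pos
  -- a fair mixture of the estimate with a uniform guess
  let Q : β → α → ℝ := fun b a => (if a = g b then 2⁻¹ else 0) + (2 * Fintype.card α : ℝ)⁻¹
  have hsum : ∀ b, ∑ a, Q b a ≤ 1 := by
    intro b
    simp only [Q, sum_add_distrib, sum_ite_eq', mem_univ, if_true, sum_const, card_univ,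
      nsmul_eq_mul]
    field_simp
    norm_num
  have hpos : ∀ b a, 0 < Q b a := fun b a => by simp only [Q]; split_ifs <;> positivity
  have hlog : ∀ ω, -logb 2 (Q (Y ω) (X ω)) ≤
      1 + if X ω = g (Y ω) then 0 else logb 2 (Fintype.card α) := by
    intro ω
    rw [← logb_inv]
    split_ifs with h <;> simp only [Q, h, if_true, if_false]
    · rw [add_zero, logb_le_iff_le_rpow one_lt_two (by positivity), rpow_one]
      exact inv_le_of_inv_le₀ two_pos (le_add_of_nonneg_right (by positivity))
    · rw [zero_add, inv_inv, logb_mul two_ne_zero hcard.ne', logb_self_eq_one one_lt_two]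
  calc condEntropy p X Y ≤ ∑ ω, p ω * -logb 2 (Q (Y ω) (X ω)) := by
        simpa only [mul_neg, sum_neg_distrib] using condEntropy_le_crossEntropy hp.1 X Y
          (fun b a => (hpos b a).le) hsum fun ω _ => hpos _ _
    _ ≤ ∑ ω, p ω * (1 + if X ω = g (Y ω) then 0 else logb 2 (Fintype.card α)) :=
        sum_le_sum fun ω _ => mul_le_mul_of_nonneg_left (hlog ω) (hp.1 ω)
    _ = _ := by
        simp only [mul_add, mul_one, sum_add_distrib, hp.2, prob, sum_mul, Set.indicator_apply,
          Set.mem_ofPred_eq, ite_not, mul_ite, mul_zero, ite_mul, zero_mul]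

end Entropy

section CondLaw

variable {Ω α β τ σ : Type*} [Fintype Ω] {p : Ω → ℝ}

/-- `κ a` is the conditional law of `T` given `A = a`, encoded by the disintegration identity for
test functions so that it does not constrain `κ a` on null events. -/
def HasCondLaw [Fintype τ] (p : Ω → ℝ) (A : Ω → α) (T : Ω → τ) (κ : α → τ → ℝ) : Prop :=
  ∀ G : α → τ → ℝ, ∑ ω, p ω * G (A ω) (T ω) = ∑ ω, p ω * ∑ t, κ (A ω) t * G (A ω) t

variable [Fintype τ] {A : Ω → α} {T : Ω → τ} {κ : α → τ → ℝ}

lemma HasCondLaw.map [Fintype σ] (h : HasCondLaw p A T κ) (f : α → τ → σ) :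
    HasCondLaw p A (fun ω => f (A ω) (T ω)) fun a => law (κ a) (f a) := by
  intro G
  simp only [h fun a t => G a (f a t), sum_law_mul]

lemma HasCondLaw.comp {g : α → β} {κ : β → τ → ℝ} (h : HasCondLaw p A T fun a => κ (g a)) :
    HasCondLaw p (fun ω => g (A ω)) T κ :=
  fun G => h fun a t => G (g a) t

lemma HasCondLaw.law_prodMk (h : HasCondLaw p A T κ) (t : τ) (a : α) :
    law p (fun ω => (T ω, A ω)) (t, a) = law p A a * κ a t := by
  classical
  have := h fun b s => if b = a ∧ s = t then 1 else 0
  simp only [mul_ite, mul_one, mul_zero, ite_and, sum_ite_eq', sum_ite_irrel, sum_const_zero,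
    mem_univ, if_true] at this
  simp only [law, Prod.mk.injEq, and_comm (a := _ = t), ite_and, sum_mul, ite_mul, zero_mul]
  convert this using 3 with ω
  rename_i hω
  rw [hω]

lemma HasCondLaw.condEntropy_eq [Fintype α] (hp : ∀ ω, 0 ≤ p ω) (h : HasCondLaw p A T κ) :
    condEntropy p T A = ∑ ω, p ω * entropy (κ (A ω)) id := by
  classical
  have hlaw : ∀ a t, law (κ a) id t = κ a t := fun a t => by simp [law]
  calc condEntropy p T A = -∑ ω, p ω * logb 2 (κ (A ω) (T ω)) := by
        rw [condEntropy_eq_sum hp]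
        congr 1
        refine sum_congr rfl fun ω _ => ?_
        rcases (hp ω).eq_or_lt with h0 | h0
        · simp [← h0]
        rw [h.law_prodMk, mul_div_cancel_left₀ _ (law_pos hp A h0).ne']
    _ = ∑ ω, p ω * entropy (κ (A ω)) id := by
        rw [h fun a t => logb 2 (κ a t)]
        simp only [entropy, hlaw, mul_neg, sum_neg_distrib]

lemma HasCondLaw.condEntropy_map_eq [Fintype α] [Fintype σ] (hp : ∀ ω, 0 ≤ p ω)
    (h : HasCondLaw p A T κ) (f : α → τ → σ) :
    condEntropy p (fun ω => f (A ω) (T ω)) A = ∑ ω, p ω * entropy (κ (A ω)) (f (A ω)) := by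
  simp only [(h.map f).condEntropy_eq hp, entropy_law, id]

lemma HasCondLaw.law_eq_sum [Fintype α] (h : HasCondLaw p A T κ) (t : τ) :
    law p T t = ∑ a, law p A a * κ a t := by
  classical
  rw [sum_law_mul p A fun a => κ a t]
  simpa [law] using h fun _ s => if s = t then 1 else 0

lemma hasCondLaw_of_law_prodMk [Finite α]
    (h : ∀ t a, law p (fun ω => (T ω, A ω)) (t, a) = law p A a * κ a t) : HasCondLaw p A T κ := by
  have := Fintype.ofFinite α
  intro G
  rw [← sum_law_mul p A fun a => ∑ t, κ a t * G a t,
    ← sum_law_mul p (fun ω => (T ω, A ω)) fun x => G x.2 x.1, Fintype.sum_prod_type_right]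
  simp only [h, mul_sum, mul_assoc]

lemma exists_hasCondLaw [Finite α] (hp : p ∈ stdSimplex ℝ Ω) (A : Ω → α) (T : Ω → τ) :
    ∃ κ : α → τ → ℝ, (∀ a, κ a ∈ stdSimplex ℝ τ) ∧ HasCondLaw p A T κ := by
  classical
  have hnonneg : ∀ t a, 0 ≤ law p (fun ω => (T ω, A ω)) (t, a) := fun t a => law_nonneg hp.1 _ _
  refine ⟨fun a => if law p A a = 0 then law p T else
    fun t => law p (fun ω => (T ω, A ω)) (t, a) / law p A a, fun a => ?_,
    hasCondLaw_of_law_prodMk fun t a => ?_⟩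
  · dsimp only
    split_ifs with h
    · exact law_mem_stdSimplex hp T
    · exact ⟨fun t => div_nonneg (hnonneg t a) (law_nonneg hp.1 A a), by
        rw [← sum_div, sum_law_prodMk, div_self h]⟩
  · split_ifs with h
    · rw [h, zero_mul]
      refine le_antisymm (h ▸ ?_) (hnonneg t a)
      rw [← sum_law_prodMk p T A a]
      exact single_le_sum (fun t _ => hnonneg t a) (mem_univ t)
    · rw [mul_div_cancel₀ _ h]

end CondLaw

section ProdLaw

variable {Ω α β τ σ : Type*} [Fintype Ω] {p : Ω → ℝ}

lemma HasCondLaw.condEntropy_comp_eq [Fintype β] [Fintype τ] [Fintype σ] {A : Ω → α}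
    {T : Ω → τ} {κ : τ → ℝ} (hp : p ∈ stdSimplex ℝ Ω) (h : HasCondLaw p A T fun _ => κ)
    (f : τ → σ) (g : α → β) :
    condEntropy p (fun ω => f (T ω)) (fun ω => g (A ω)) = entropy κ f := by
  rw [(h.comp (κ := fun _ => κ) (g := g)).condEntropy_map_eq hp.1 fun _ => f, ← sum_mul, hp.2,
    one_mul]

lemma HasCondLaw.entropy_comp_eq [Fintype τ] [Fintype σ] {A : Ω → α} {T : Ω → τ} {κ : τ → ℝ}
    (hp : p ∈ stdSimplex ℝ Ω) (h : HasCondLaw p A T fun _ => κ) (f : τ → σ) :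
    entropy p (fun ω => f (T ω)) = entropy κ f := by
  rw [← condEntropy_of_subsingleton hp.2 _ fun _ => (), h.condEntropy_comp_eq hp f fun _ => ()]

/-- The joint law of independent random variables with laws `κ` and `η`. -/
def prodLaw (κ : α → ℝ) (η : β → ℝ) (c : α × β) : ℝ := κ c.1 * η c.2

variable [Fintype α] [Fintype β] {κ : α → ℝ} {η : β → ℝ}

lemma prodLaw_mem_stdSimplex (hκ : κ ∈ stdSimplex ℝ α) (hη : η ∈ stdSimplex ℝ β) :
    prodLaw κ η ∈ stdSimplex ℝ (α × β) :=
  ⟨fun c => mul_nonneg (hκ.1 c.1) (hη.1 c.2), by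
    simp only [prodLaw, Fintype.sum_prod_type, ← mul_sum, hη.2, mul_one, hκ.2]⟩

lemma law_prodLaw_fst (κ : α → ℝ) (hη : ∑ b, η b = 1) : law (prodLaw κ η) Prod.fst = κ := by
  classical
  ext a
  simp [law, prodLaw, Fintype.sum_prod_type, ← mul_sum, hη]

lemma law_prodLaw_snd (hκ : ∑ a, κ a = 1) (η : β → ℝ) : law (prodLaw κ η) Prod.snd = η := by
  classical
  ext b
  simp [law, prodLaw, Fintype.sum_prod_type, ← sum_mul, hκ]

lemma entropy_prodLaw (hκ : κ ∈ stdSimplex ℝ α) (hη : η ∈ stdSimplex ℝ β) :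
    entropy (prodLaw κ η) id = entropy κ id + entropy η id := by
  have hfst : entropy (prodLaw κ η) Prod.fst = entropy κ id := by
    rw [← law_prodLaw_fst κ hη.2, entropy_law, law_prodLaw_fst κ hη.2]; rfl
  have hsnd : HasCondLaw (prodLaw κ η) Prod.fst Prod.snd fun _ => η := by
    intro G
    simp only [Fintype.sum_prod_type, prodLaw, mul_assoc, ← mul_sum, ← sum_mul, hη.2, one_mul]
  have hcond := hsnd.condEntropy_comp_eq (prodLaw_mem_stdSimplex hκ hη) id id
  have hswap : entropy (prodLaw κ η) (fun c => (c.2, c.1)) = entropy (prodLaw κ η) id :=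
    entropy_congr fun c c' => by simp [Prod.ext_iff, and_comm]
  rw [condEntropy] at hcond
  simp only [id] at hcond hswap ⊢
  linarith!

end ProdLaw

section CausalLaw

variable {α : Type*} {n : ℕ}

lemma past_eq_iff {y z : Fin n → α} {i : Fin n} :
    past y i = past z i ↔ ∀ j < i, y j = z j := by
  simp only [past, funext_iff]
  exact ⟨fun h j hj => h ⟨j, hj⟩, fun h j => h _ j.2⟩

lemma past_snoc_castSucc (y : Fin n → α) (t : α) (j : Fin n) :
    past (Fin.snoc (α := fun _ => α) y t) j.castSucc = past y j := by
  funext l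
  exact Fin.snoc_castSucc (α := fun _ => α) t y ⟨l, l.2.trans j.2⟩

lemma past_snoc_last (y : Fin n → α) (t : α) :
    past (Fin.snoc (α := fun _ => α) y t) (Fin.last n) = y := by
  funext l
  exact Fin.snoc_castSucc (α := fun _ => α) t y l

/-- The joint law of a sequence in which `k i` is the conditional law of the `i`-th symbol given the
symbols before it. -/
def causalLaw (k : (i : Fin n) → (Fin (i : ℕ) → α) → α → ℝ) (y : Fin n → α) : ℝ :=
  ∏ i, k i (past y i) (y i)

lemma causalLaw_snoc (k : (i : Fin (n + 1)) → (Fin (i : ℕ) → α) → α → ℝ) (y : Fin n → α) (t : α) :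
    causalLaw k (Fin.snoc (α := fun _ => α) y t) =
      causalLaw (fun i => k i.castSucc) y * k (Fin.last n) y t := by
  simp only [causalLaw, Fin.prod_univ_castSucc, past_snoc_castSucc, past_snoc_last,
    Fin.snoc_castSucc (α := fun _ => α) t y, Fin.snoc_last (α := fun _ => α) t y]

variable [Fintype α]

lemma sum_fin_snoc (F : (Fin (n + 1) → α) → ℝ) :
    ∑ y, F y = ∑ y : Fin n → α, ∑ t : α, F (Fin.snoc (α := fun _ => α) y t) := by
  rw [← (Fin.snocEquiv fun _ : Fin (n + 1) => α).sum_comp, Fintype.sum_prod_type_right]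
  rfl

lemma sum_causalLaw (k : (i : Fin n) → (Fin (i : ℕ) → α) → α → ℝ)
    (hk : ∀ i h, ∑ t, k i h t = 1) : ∑ y, causalLaw k y = 1 := by
  induction n with
  | zero => simp [causalLaw]
  | succ n ih =>
    simp only [sum_fin_snoc, causalLaw_snoc, ← mul_sum, hk, mul_one]
    exact ih _ fun i => hk i.castSucc

lemma hasCondLaw_causalLaw (k : (i : Fin n) → (Fin (i : ℕ) → α) → α → ℝ)
    (hk : ∀ i h, ∑ t, k i h t = 1) (i : Fin n) :
    HasCondLaw (causalLaw k) (past · i) (· i) (k i) := by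
  intro G
  induction n with
  | zero => exact i.elim0
  | succ n ih =>
    simp only [sum_fin_snoc, causalLaw_snoc]
    induction i using Fin.lastCases with
    | last =>
      simp only [past_snoc_last, Fin.snoc_last, mul_assoc, ← mul_sum, ← sum_mul, hk, one_mul]
    | cast i =>
      simp only [past_snoc_castSucc, Fin.snoc_castSucc, ← sum_mul, ← mul_sum, hk, mul_one]
      exact ih (fun j => k j.castSucc) (fun j => hk j.castSucc) i G

end CausalLaw

section ChainRule

variable {Ω β γ τ : Type*} [Fintype Ω] [Fintype β] [Fintype γ] [Fintype τ] {p : Ω → ℝ} {n : ℕ}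

lemma condEntropy_eq_sum_past (Y : Ω → Fin n → τ) (B : Ω → β) :
    condEntropy p Y B =
      ∑ i, condEntropy p (fun ω => Y ω i) (fun ω => (B ω, past (Y ω) i)) := by
  induction n with
  | zero =>
    rw [condEntropy, entropy_congr (Y := B) fun ω ω' => by simp [Subsingleton.elim (Y ω) (Y ω')]]
    simp
  | succ n ih =>
    have hsplit : condEntropy p Y B =
        condEntropy p (fun ω => (Fin.init (Y ω), Y ω (Fin.last n))) B :=
      condEntropy_congr (by simp) fun ω ω' _ => by
        simp only [Prod.mk.injEq, funext_iff, Fin.forall_fin_succ', Fin.init]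
    rw [hsplit, condEntropy_prodMk, ih, Fin.sum_univ_castSucc]
    congr 1
    exact condEntropy_congr (fun ω ω' => by simp only [Prod.mk.injEq, and_comm]; rfl) (by simp)

/-- Fano's inequality combined with the chain rule for `I(C; Yⁿ | B)`. -/
lemma condEntropy_le_add_sum_past (hp : p ∈ stdSimplex ℝ Ω) (Y : Ω → Fin n → τ) (B : Ω → β)
    (C : Ω → γ) (g : (Fin n → τ) → β → γ) :
    condEntropy p C B ≤
      1 + prob p {ω | C ω ≠ g (Y ω) (B ω)} * logb 2 (Fintype.card γ) +
        ∑ i, (condEntropy p (fun ω => Y ω i) (fun ω => (B ω, past (Y ω) i)) -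
          condEntropy p (fun ω => Y ω i) (fun ω => ((C ω, B ω), past (Y ω) i))) := by
  have hinfo := condMutualInfo_eq (p := p) C Y B
  rw [condMutualInfo, condEntropy_eq_sum_past, condEntropy_eq_sum_past, ← sum_sub_distrib] at hinfo
  have hfano := condEntropy_le_prob_ne hp C (fun ω => (Y ω, B ω)) fun x => g x.1 x.2
  linarith

lemma logb_card_le_condEntropy_of_uniform {μ : Type*} [Fintype μ] (hp : p ∈ stdSimplex ℝ Ω)
    {M : Ω → μ} (hM : ∀ m, law p M m = (Fintype.card μ : ℝ)⁻¹) (e : μ ≃ γ × β) :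
    logb 2 (Fintype.card γ) ≤
      condEntropy p (fun ω => (e (M ω)).1) (fun ω => (e (M ω)).2) := by
  have hne : Nonempty (γ × β) := (nonempty_of_mem_stdSimplex hp).map fun ω => e (M ω)
  rw [nonempty_prod] at hne
  obtain ⟨_, _⟩ := hne
  have hH : entropy p M = logb 2 (Fintype.card γ) + logb 2 (Fintype.card β) := by
    rw [← logb_mul (Nat.cast_ne_zero.2 Fintype.card_ne_zero)
      (Nat.cast_ne_zero.2 Fintype.card_ne_zero), ← Nat.cast_mul, ← Fintype.card_prod,
      ← Fintype.card_congr e, entropy_eq]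
    simp only [hM, ← sum_mul, hp.2, one_mul, logb_inv, neg_neg]
  have hpair : entropy p (fun ω => ((e (M ω)).1, (e (M ω)).2)) = entropy p M :=
    entropy_congr fun ω ω' => by simp
  rw [condEntropy, hpair, hH]
  linarith [entropy_le_logb_card hp fun ω => (e (M ω)).2]

end ChainRule

section Sample

variable {q : ℕ} {𝒴 : Type*} {n : ℕ} {R₁₃ R₂₃ R₃₁ R₃₂ : ℝ}

/-- The values of the four messages. -/
structure Messages (n : ℕ) (R₁₃ R₂₃ R₃₁ R₃₂ : ℝ) where
  M₁₃ : Msg n R₁₃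
  M₂₃ : Msg n R₂₃
  M₃₁ : Msg n R₃₁
  M₃₂ : Msg n R₃₂

/-- Message quadruples are tuples. -/
def Messages.equivProd (n : ℕ) (R₁₃ R₂₃ R₃₁ R₃₂ : ℝ) :
    Messages n R₁₃ R₂₃ R₃₁ R₃₂ ≃ Msg n R₁₃ × Msg n R₂₃ × Msg n R₃₁ × Msg n R₃₂ where
  toFun m := (m.M₁₃, m.M₂₃, m.M₃₁, m.M₃₂)
  invFun t := ⟨t.1, t.2.1, t.2.2.1, t.2.2.2⟩

noncomputable instance : Fintype (Messages n R₁₃ R₂₃ R₃₁ R₃₂) :=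
  Fintype.ofEquiv _ (Messages.equivProd n R₁₃ R₂₃ R₃₁ R₃₂).symm

/-- The values of the channel outputs `(Y₁, Y₂, Y₃)` at a given time. -/
structure Output (q : ℕ) (𝒴 : Type*) where
  Y₁ : ZMod q
  Y₂ : ZMod q
  Y₃ : 𝒴

/-- Outputs are tuples. -/
def Output.equivProd (q : ℕ) (𝒴 : Type*) : Output q 𝒴 ≃ ZMod q × ZMod q × 𝒴 where
  toFun y := (y.Y₁, y.Y₂, y.Y₃)
  invFun t := ⟨t.1, t.2.1, t.2.2⟩

instance [NeZero q] [Fintype 𝒴] : Fintype (Output q 𝒴) :=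
  Fintype.ofEquiv _ (Output.equivProd q 𝒴).symm

/-- For fixed inputs, the outputs `(Y₁, Y₂, Y₃)` and the triple `(Y₃, Z₁, Z₂)` determine each
other. -/
def outputEquiv (𝒴 : Type*) (x₁ x₂ x₃ : ZMod q) : Output q 𝒴 ≃ 𝒴 × ZMod q × ZMod q where
  toFun y := (y.Y₃, y.Y₁ - x₁ - x₃, y.Y₂ - x₂ - y.Y₁ + x₁)
  invFun t := ⟨t.2.1 + x₁ + x₃, t.2.2 + x₂ + (t.2.1 + x₁ + x₃) - x₁, t.1⟩
  left_inv y := by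
    obtain ⟨y₁, y₂, y₃⟩ := y
    simp only [Output.mk.injEq, and_true]
    exact ⟨by ring, by ring⟩
  right_inv t := by ext <;> dsimp only <;> ring

/-- The messages and the output sequence of a transmission. -/
abbrev Sample (q : ℕ) (𝒴 : Type*) (n : ℕ) (R₁₃ R₂₃ R₃₁ R₃₂ : ℝ) : Type _ :=
  Messages n R₁₃ R₂₃ R₃₁ R₃₂ × (Fin n → Output q 𝒴)

/-- The messages and the outputs before time `i`. -/
abbrev History (q : ℕ) (𝒴 : Type*) (R₁₃ R₂₃ R₃₁ R₃₂ : ℝ) (i : Fin n) : Type _ :=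
  Messages n R₁₃ R₂₃ R₃₁ R₃₂ × (Fin (i : ℕ) → Output q 𝒴)

/-- The history of a transmission up to time `i`. -/
def history (i : Fin n) (ω : Sample q 𝒴 n R₁₃ R₂₃ R₃₁ R₃₂) : History q 𝒴 R₁₃ R₂₃ R₃₁ R₃₂ i :=
  (ω.1, past ω.2 i)

namespace Code

variable (c : Code q 𝒴 n R₁₃ R₂₃ R₃₁ R₃₂)

/-- The input of user 1 at time `i` as a function of the history. -/
def input₁ (i : Fin n) (h : History q 𝒴 R₁₃ R₂₃ R₃₁ R₃₂ i) : ZMod q :=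
  c.f₁ i h.1.M₁₃ fun j => (h.2 j).Y₁

/-- The input of user 2 at time `i` as a function of the history. -/
def input₂ (i : Fin n) (h : History q 𝒴 R₁₃ R₂₃ R₃₁ R₃₂ i) : ZMod q :=
  c.f₂ i h.1.M₂₃ fun j => (h.2 j).Y₂

/-- The input of user 3 at time `i` as a function of the history. -/
def input₃ (i : Fin n) (h : History q 𝒴 R₁₃ R₂₃ R₃₁ R₃₂ i) : ZMod q :=
  c.f₃ i h.1.M₃₁ h.1.M₃₂ fun j => (h.2 j).Y₃

/-- The input sequence of user 1. -/
def X₁ (ω : Sample q 𝒴 n R₁₃ R₂₃ R₃₁ R₃₂) (i : Fin n) : ZMod q := c.input₁ i (history i ω)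

/-- The input sequence of user 2. -/
def X₂ (ω : Sample q 𝒴 n R₁₃ R₂₃ R₃₁ R₃₂) (i : Fin n) : ZMod q := c.input₂ i (history i ω)

/-- The input sequence of user 3. -/
def X₃ (ω : Sample q 𝒴 n R₁₃ R₂₃ R₃₁ R₃₂) (i : Fin n) : ZMod q := c.input₃ i (history i ω)

/-- The input triples. -/
def X (ω : Sample q 𝒴 n R₁₃ R₂₃ R₃₁ R₃₂) (i : Fin n) : ZMod q × ZMod q × ZMod q :=
  (c.X₁ ω i, c.X₂ ω i, c.X₃ ω i)

/-- The observations `(Y₃, Z₁, Z₂)`: what user 3 sees when the noise of the other users is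
revealed to it. -/
def obs (ω : Sample q 𝒴 n R₁₃ R₂₃ R₃₁ R₃₂) (i : Fin n) : 𝒴 × ZMod q × ZMod q :=
  outputEquiv 𝒴 (c.X₁ ω i) (c.X₂ ω i) (c.X₃ ω i) (ω.2 i)

/-- The noise sequence of user 1. -/
def Z₁ (ω : Sample q 𝒴 n R₁₃ R₂₃ R₃₁ R₃₂) (i : Fin n) : ZMod q := (c.obs ω i).2.1

/-- The additional noise sequence of user 2. -/
def Z₂ (ω : Sample q 𝒴 n R₁₃ R₂₃ R₃₁ R₃₂) (i : Fin n) : ZMod q := (c.obs ω i).2.2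

variable {c} {i : Fin n} {ω ω' : Sample q 𝒴 n R₁₃ R₂₃ R₃₁ R₃₂}

lemma obs_eq : c.obs ω i = ((ω.2 i).Y₃, c.Z₁ ω i, c.Z₂ ω i) := rfl

lemma Y₁_eq : (ω.2 i).Y₁ = c.X₁ ω i + (c.X₃ ω i + c.Z₁ ω i) := by
  simp only [Z₁, obs, outputEquiv, Equiv.coe_fn_mk]
  ring

lemma Y₂_eq : (ω.2 i).Y₂ = c.X₂ ω i + (c.X₃ ω i + c.Z₁ ω i + c.Z₂ ω i) := by
  simp only [Z₁, Z₂, obs, outputEquiv, Equiv.coe_fn_mk]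
  ring

lemma X₁_congr (hm : ω.1.M₁₃ = ω'.1.M₁₃) (h : ∀ j < i, (ω.2 j).Y₁ = (ω'.2 j).Y₁) :
    c.X₁ ω i = c.X₁ ω' i := by
  simp only [X₁, input₁, history, hm]
  exact congrArg _ (past_eq_iff.2 h)

lemma X₂_congr (hm : ω.1.M₂₃ = ω'.1.M₂₃) (h : ∀ j < i, (ω.2 j).Y₂ = (ω'.2 j).Y₂) :
    c.X₂ ω i = c.X₂ ω' i := by
  simp only [X₂, input₂, history, hm]
  exact congrArg _ (past_eq_iff.2 h)

lemma X₃_congr_obs (hm : ω.1.M₃₁ = ω'.1.M₃₁) (hm' : ω.1.M₃₂ = ω'.1.M₃₂)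
    (h : past (c.obs ω) i = past (c.obs ω') i) : c.X₃ ω i = c.X₃ ω' i := by
  simp only [X₃, input₃, history, hm, hm']
  exact congrArg _ (past_eq_iff.2 fun j hj => congrArg Prod.fst (past_eq_iff.1 h j hj))

lemma past_obs_congr_of_lt (h : past (c.obs ω) i = past (c.obs ω') i) {j : Fin n} (hj : j < i) :
    past (c.obs ω) j = past (c.obs ω') j :=
  past_eq_iff.2 fun l hl => past_eq_iff.1 h l (hl.trans hj)

lemma X₁_congr_obs (hm : ω.1.M₁₃ = ω'.1.M₁₃) (hm₁ : ω.1.M₃₁ = ω'.1.M₃₁)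
    (hm₂ : ω.1.M₃₂ = ω'.1.M₃₂) (h : past (c.obs ω) i = past (c.obs ω') i) :
    c.X₁ ω i = c.X₁ ω' i := by
  induction i using WellFoundedLT.induction with
  | ind i ih =>
    refine X₁_congr hm fun j hj => ?_
    have hpast := past_obs_congr_of_lt h hj
    rw [Y₁_eq (c := c), Y₁_eq (c := c), ih j hj hpast, X₃_congr_obs hm₁ hm₂ hpast, Z₁, Z₁,
      past_eq_iff.1 h j hj]

lemma X₂_congr_obs (hm : ω.1.M₂₃ = ω'.1.M₂₃) (hm₁ : ω.1.M₃₁ = ω'.1.M₃₁)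
    (hm₂ : ω.1.M₃₂ = ω'.1.M₃₂) (h : past (c.obs ω) i = past (c.obs ω') i) :
    c.X₂ ω i = c.X₂ ω' i := by
  induction i using WellFoundedLT.induction with
  | ind i ih =>
    refine X₂_congr hm fun j hj => ?_
    have hpast := past_obs_congr_of_lt h hj
    rw [Y₂_eq (c := c), Y₂_eq (c := c), ih j hj hpast, X₃_congr_obs hm₁ hm₂ hpast, Z₁, Z₁, Z₂, Z₂,
      past_eq_iff.1 h j hj]

lemma obs_eq_iff (h : history i ω = history i ω') :
    c.obs ω i = c.obs ω' i ↔ ω.2 i = ω'.2 i := by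
  simp only [obs, X₁, X₂, X₃, h, EmbeddingLike.apply_eq_iff_eq]

lemma history_eq_iff :
    history i ω = history i ω' ↔ ω.1 = ω'.1 ∧ past (c.obs ω) i = past (c.obs ω') i := by
  simp only [history, Prod.mk.injEq]
  refine and_congr_right fun hm => ?_
  constructor <;> intro h <;> refine past_eq_iff.2 fun j hj => ?_
  · have hj' : history j ω = history j ω' := Prod.ext hm <|
      past_eq_iff.2 fun l hl => past_eq_iff.1 h l (hl.trans hj)
    exact (obs_eq_iff hj').2 (past_eq_iff.1 h j hj)
  · have hpast := past_obs_congr_of_lt h hj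
    have hobs := past_eq_iff.1 h j hj
    rw [obs, obs, X₁_congr_obs (by rw [hm]) (by rw [hm]) (by rw [hm]) hpast,
      X₂_congr_obs (by rw [hm]) (by rw [hm]) (by rw [hm]) hpast,
      X₃_congr_obs (by rw [hm]) (by rw [hm]) hpast] at hobs
    exact (outputEquiv 𝒴 _ _ _).injective hobs

end Code

end Sample

section SampleProb

variable {q : ℕ} [NeZero q] {𝒴 : Type*} [Fintype 𝒴] {n : ℕ} {R₁₃ R₂₃ R₃₁ R₃₂ : ℝ}
  (W : Channel q 𝒴)

namespace Channel

/-- The joint law of `(Z₁, Z₂)`. -/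
def noiseLaw : ZMod q × ZMod q → ℝ := prodLaw W.PZ1 W.PZ2

/-- The joint law of `(Y₃, Z₁, Z₂)` for the inputs `x₁, x₂, x₃`. -/
def kernel (x₁ x₂ x₃ : ZMod q) : 𝒴 × ZMod q × ZMod q → ℝ := prodLaw (W.PY3 x₁ x₂ x₃) W.noiseLaw

lemma noiseLaw_mem_stdSimplex : W.noiseLaw ∈ stdSimplex ℝ (ZMod q × ZMod q) :=
  prodLaw_mem_stdSimplex W.PZ1_mem W.PZ2_mem

lemma kernel_mem_stdSimplex (x₁ x₂ x₃ : ZMod q) :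
    W.kernel x₁ x₂ x₃ ∈ stdSimplex ℝ (𝒴 × ZMod q × ZMod q) :=
  prodLaw_mem_stdSimplex (W.PY3_mem x₁ x₂ x₃) W.noiseLaw_mem_stdSimplex

end Channel

variable (c : Code q 𝒴 n R₁₃ R₂₃ R₃₁ R₃₂)

/-- The transition probability of the channel at time `i` when the code is used to send `m`. -/
def stepKernel (m : Messages n R₁₃ R₂₃ R₃₁ R₃₂) (i : Fin n) (h : Fin (i : ℕ) → Output q 𝒴)
    (y : Output q 𝒴) : ℝ :=
  W.kernel (c.input₁ i (m, h)) (c.input₂ i (m, h)) (c.input₃ i (m, h))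
    (outputEquiv 𝒴 (c.input₁ i (m, h)) (c.input₂ i (m, h)) (c.input₃ i (m, h)) y)

lemma sum_stepKernel (m : Messages n R₁₃ R₂₃ R₃₁ R₃₂) (i : Fin n)
    (h : Fin (i : ℕ) → Output q 𝒴) : ∑ y, stepKernel W c m i h y = 1 :=
  ((outputEquiv 𝒴 _ _ _).sum_comp _).trans (W.kernel_mem_stdSimplex _ _ _).2

/-- The joint law of the messages and the outputs. -/
noncomputable def sampleProb (ω : Sample q 𝒴 n R₁₃ R₂₃ R₃₁ R₃₂) : ℝ :=
  (Fintype.card (Messages n R₁₃ R₂₃ R₃₁ R₃₂) : ℝ)⁻¹ * causalLaw (stepKernel W c ω.1) ω.2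

lemma jointProb_eq (ω : Sample q 𝒴 n R₁₃ R₂₃ R₃₁ R₃₂) :
    jointProb W c ω.1.M₁₃ ω.1.M₂₃ ω.1.M₃₁ ω.1.M₃₂ (fun i => (ω.2 i).Y₁) (fun i => (ω.2 i).Y₂)
      (fun i => (ω.2 i).Y₃) = sampleProb W c ω := by
  rw [sampleProb, Fintype.card_congr (Messages.equivProd n R₁₃ R₂₃ R₃₁ R₃₂)]
  simp only [Fintype.card_prod, Nat.cast_mul, mul_inv, ← mul_assoc]
  exact congrArg _ (prod_congr rfl fun i _ => mul_assoc ..)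

lemma sampleProb_nonneg (ω : Sample q 𝒴 n R₁₃ R₂₃ R₃₁ R₃₂) : 0 ≤ sampleProb W c ω :=
  mul_nonneg (by positivity) (prod_nonneg fun _ _ => (W.kernel_mem_stdSimplex _ _ _).1 _)

lemma law_sampleProb_messages (m : Messages n R₁₃ R₂₃ R₃₁ R₃₂) :
    law (sampleProb W c) Prod.fst m = (Fintype.card (Messages n R₁₃ R₂₃ R₃₁ R₃₂) : ℝ)⁻¹ := by
  classical
  simp only [law, sampleProb, Fintype.sum_prod_type, sum_ite_irrel, sum_const_zero, sum_ite_eq',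
    mem_univ, if_true, ← mul_sum, sum_causalLaw _ (sum_stepKernel W c m), mul_one]

lemma sampleProb_mem_stdSimplex [Nonempty (Messages n R₁₃ R₂₃ R₃₁ R₃₂)] :
    sampleProb W c ∈ stdSimplex ℝ (Sample q 𝒴 n R₁₃ R₂₃ R₃₁ R₃₂) := by
  refine ⟨sampleProb_nonneg W c, ?_⟩
  simp [← sum_law _ Prod.fst, law_sampleProb_messages]

lemma hasCondLaw_obs (i : Fin n) :
    HasCondLaw (sampleProb W c) (history i) (c.obs · i)
      fun h => W.kernel (c.input₁ i h) (c.input₂ i h) (c.input₃ i h) := by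
  intro G
  refine (Fintype.sum_prod_type _).trans (.trans ?_ (Fintype.sum_prod_type _).symm)
  simp only [sampleProb, mul_assoc, ← mul_sum]
  refine congrArg _ (sum_congr rfl fun m _ => ?_)
  refine (hasCondLaw_causalLaw (stepKernel W c m) (sum_stepKernel W c m) i fun h y =>
    G (m, h) (outputEquiv 𝒴 (c.input₁ i (m, h)) (c.input₂ i (m, h)) (c.input₃ i (m, h)) y)).trans
      (sum_congr rfl fun y _ => congrArg _ ?_)
  exact (outputEquiv 𝒴 _ _ _).sum_comp fun t => W.kernel _ _ _ t * G (m, past y i) t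

/-- The event that at least one message is decoded wrongly. -/
def Code.errorEvent (c : Code q 𝒴 n R₁₃ R₂₃ R₃₁ R₃₂) : Set (Sample q 𝒴 n R₁₃ R₂₃ R₃₁ R₃₂) :=
  {ω | (c.g₃ ω.1.M₃₁ ω.1.M₃₂ fun i => (ω.2 i).Y₃).1 ≠ ω.1.M₁₃ ∨
    (c.g₃ ω.1.M₃₁ ω.1.M₃₂ fun i => (ω.2 i).Y₃).2 ≠ ω.1.M₂₃ ∨
    c.g₁ ω.1.M₁₃ (fun i => (ω.2 i).Y₁) ≠ ω.1.M₃₁ ∨ c.g₂ ω.1.M₂₃ (fun i => (ω.2 i).Y₂) ≠ ω.1.M₃₂}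

lemma errorProb_eq_prob : errorProb W c = prob (sampleProb W c) c.errorEvent := by
  classical
  let e : (Fin n → Output q 𝒴) ≃ (Fin n → ZMod q) × (Fin n → ZMod q) × (Fin n → 𝒴) :=
    { toFun := fun y => (fun i => (y i).Y₁, fun i => (y i).Y₂, fun i => (y i).Y₃)
      invFun := fun z i => ⟨z.1 i, z.2.1 i, z.2.2 i⟩ }
  have hprob : ∀ ω, c.errorEvent.indicator (sampleProb W c) ω =
      if ω ∈ c.errorEvent then jointProb W c ω.1.M₁₃ ω.1.M₂₃ ω.1.M₃₁ ω.1.M₃₂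
        (fun i => (ω.2 i).Y₁) (fun i => (ω.2 i).Y₂) (fun i => (ω.2 i).Y₃) else 0 := fun ω => by
    rw [Set.indicator_apply, jointProb_eq]
  simp only [prob, hprob]
  rw [Fintype.sum_prod_type, ← (Messages.equivProd n R₁₃ R₂₃ R₃₁ R₃₂).symm.sum_comp]
  simp only [← e.symm.sum_comp, Fintype.sum_prod_type]
  rw [errorProb]
  congr!

end SampleProb

section AuxVar

variable {q : ℕ} {𝒴 : Type*} {n : ℕ} {R₁₃ R₂₃ R₃₁ R₃₂ : ℝ}
  {c : Code q 𝒴 n R₁₃ R₂₃ R₃₁ R₃₂} {i : Fin n} {ω ω' : Sample q 𝒴 n R₁₃ R₂₃ R₃₁ R₃₂}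

/-- The auxiliary random variable at time `i`: all messages but `M₃₁`, and the past outputs of
users 1 and 2. -/
def auxVar (i : Fin n) (ω : Sample q 𝒴 n R₁₃ R₂₃ R₃₁ R₃₂) :
    (Msg n R₁₃ × Msg n R₂₃ × Msg n R₃₂) × (Fin (i : ℕ) → ZMod q × ZMod q) :=
  ((ω.1.M₁₃, ω.1.M₂₃, ω.1.M₃₂), past (fun j => ((ω.2 j).Y₁, (ω.2 j).Y₂)) i)

lemma auxVar_eq_iff : auxVar i ω = auxVar i ω' ↔
    (ω.1.M₁₃ = ω'.1.M₁₃ ∧ ω.1.M₂₃ = ω'.1.M₂₃ ∧ ω.1.M₃₂ = ω'.1.M₃₂) ∧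
      ∀ j < i, (ω.2 j).Y₁ = (ω'.2 j).Y₁ ∧ (ω.2 j).Y₂ = (ω'.2 j).Y₂ := by
  simp only [auxVar, Prod.mk.injEq, past_eq_iff]

lemma Code.X₁_congr_auxVar (h : auxVar i ω = auxVar i ω') : c.X₁ ω i = c.X₁ ω' i :=
  X₁_congr (auxVar_eq_iff.1 h).1.1 fun j hj => ((auxVar_eq_iff.1 h).2 j hj).1

lemma Code.X₂_congr_auxVar (h : auxVar i ω = auxVar i ω') : c.X₂ ω i = c.X₂ ω' i :=
  X₂_congr (auxVar_eq_iff.1 h).1.2.1 fun j hj => ((auxVar_eq_iff.1 h).2 j hj).2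

lemma auxVar_congr_history (h : history i ω = history i ω') : auxVar i ω = auxVar i ω' := by
  obtain ⟨hm, hpast⟩ := Prod.mk.inj h
  rw [auxVar_eq_iff, hm]
  exact ⟨⟨rfl, rfl, rfl⟩, fun j hj => by simp only [past_eq_iff.1 hpast j hj, and_self]⟩

lemma Code.recv_eq_iff_of_auxVar_eq (h : auxVar i ω = auxVar i ω') :
    ((ω.2 i).Y₁ = (ω'.2 i).Y₁ ∧ (ω.2 i).Y₂ = (ω'.2 i).Y₂) ↔
      c.X₃ ω i + c.Z₁ ω i = c.X₃ ω' i + c.Z₁ ω' i ∧ c.Z₂ ω i = c.Z₂ ω' i := by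
  rw [Y₁_eq (c := c), Y₁_eq (c := c), Y₂_eq (c := c), Y₂_eq (c := c), X₁_congr_auxVar h,
    X₂_congr_auxVar h, add_right_inj, add_right_inj]
  exact and_congr_right fun h₁ => by rw [h₁, add_right_inj]

end AuxVar

section Converse

variable {q : ℕ} [NeZero q] {𝒴 : Type*} [Fintype 𝒴] {n : ℕ} {R₁₃ R₂₃ R₃₁ R₃₂ : ℝ}
  (W : Channel q 𝒴) (c : Code q 𝒴 n R₁₃ R₂₃ R₃₁ R₃₂)

lemma hasCondLaw_Y₃ (i : Fin n) :
    HasCondLaw (sampleProb W c) (c.X · i) (fun ω => (ω.2 i).Y₃)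
      fun x => W.PY3 x.1 x.2.1 x.2.2 := by
  have hobs : HasCondLaw (sampleProb W c) (c.X · i) (c.obs · i)
      fun x => W.kernel x.1 x.2.1 x.2.2 :=
    (hasCondLaw_obs W c i).comp (g := fun h => (c.input₁ i h, c.input₂ i h, c.input₃ i h))
  simpa only [Code.obs_eq, Channel.kernel, law_prodLaw_fst _ W.noiseLaw_mem_stdSimplex.2] using
    hobs.map fun _ => Prod.fst

lemma hasCondLaw_noise (i : Fin n) :
    HasCondLaw (sampleProb W c) (history i) (fun ω => (c.Z₁ ω i, c.Z₂ ω i))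
      fun _ => W.noiseLaw := by
  simpa only [Code.obs_eq, Channel.kernel, law_prodLaw_snd (W.PY3_mem _ _ _).2] using
    (hasCondLaw_obs W c i).map fun _ => Prod.snd

lemma hasCondLaw_Z₁ (i : Fin n) :
    HasCondLaw (sampleProb W c) (history i) (c.Z₁ · i) fun _ => W.PZ1 := by
  simpa only [Channel.noiseLaw, law_prodLaw_fst _ W.PZ2_mem.2] using
    (hasCondLaw_noise W c i).map fun _ => Prod.fst

lemma hasCondLaw_Z₂ (i : Fin n) :
    HasCondLaw (sampleProb W c) (history i) (c.Z₂ · i) fun _ => W.PZ2 := by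
  simpa only [Channel.noiseLaw, law_prodLaw_snd W.PZ1_mem.2] using
    (hasCondLaw_noise W c i).map fun _ => Prod.snd

variable [Nonempty (Messages n R₁₃ R₂₃ R₃₁ R₃₂)]

lemma condEntropy_obs_history (i : Fin n) :
    condEntropy (sampleProb W c) (c.obs · i) (history i) =
      condEntropy (sampleProb W c) (fun ω => (ω.2 i).Y₃) (c.X · i) + entropy W.noiseLaw id := by
  have hp := sampleProb_mem_stdSimplex W c
  rw [(hasCondLaw_obs W c i).condEntropy_eq hp.1, (hasCondLaw_Y₃ W c i).condEntropy_eq hp.1]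
  simp only [Channel.kernel, entropy_prodLaw (W.PY3_mem _ _ _) W.noiseLaw_mem_stdSimplex, mul_add,
    sum_add_distrib, ← sum_mul, hp.2, one_mul]
  rfl

variable {β γ δ τ : Type*} [Finite β] [Fintype γ] [Fintype δ] [Fintype τ]

lemma logb_card_le_add_sum (e : Messages n R₁₃ R₂₃ R₃₁ R₃₂ ≃ γ × β) (k : β → δ)
    (Y : Sample q 𝒴 n R₁₃ R₂₃ R₃₁ R₃₂ → Fin n → τ) (g : (Fin n → τ) → δ → γ)
    (hg : {ω | (e ω.1).1 ≠ g (Y ω) (k (e ω.1).2)} ⊆ c.errorEvent) :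
    logb 2 (Fintype.card γ) ≤ 1 + errorProb W c * logb 2 (Fintype.card γ) +
      ∑ i, (condEntropy (sampleProb W c) (fun ω => Y ω i)
          (fun ω => (k (e ω.1).2, past (Y ω) i)) -
        condEntropy (sampleProb W c) (fun ω => Y ω i)
          (fun ω => (((e ω.1).1, k (e ω.1).2), past (Y ω) i))) := by
  have hp := sampleProb_mem_stdSimplex W c
  have := Fintype.ofFinite β
  calc logb 2 (Fintype.card γ)
      ≤ condEntropy (sampleProb W c) (fun ω => (e ω.1).1) (fun ω => (e ω.1).2) :=
        logb_card_le_condEntropy_of_uniform hp (law_sampleProb_messages W c) e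
    _ ≤ condEntropy (sampleProb W c) (fun ω => (e ω.1).1) (fun ω => k (e ω.1).2) :=
        condEntropy_anti hp.1 _ fun _ _ h => congrArg k h
    _ ≤ _ := (condEntropy_le_add_sum_past hp Y _ _ g).trans <| by
        rw [errorProb_eq_prob]
        gcongr
        · exact div_nonneg (log_natCast_nonneg _) (log_nonneg one_le_two)
        · exact prob_mono hp.1 hg

/-- In the multiple-access direction, user 3 decodes from `(Y₃, Z₁, Z₂)`; the noise entropies
cancel, while knowing the noise lets it reconstruct the inputs of the users whose messages are
known. -/
lemma mac_converse (e : Messages n R₁₃ R₂₃ R₃₁ R₃₂ ≃ γ × β) (g : (Fin n → 𝒴) → β → γ)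
    (hg : {ω | (e ω.1).1 ≠ g (fun i => (ω.2 i).Y₃) (e ω.1).2} ⊆ c.errorEvent)
    (f : ZMod q × ZMod q × ZMod q → δ)
    (hf : ∀ (i : Fin n) ω ω', (e ω.1).2 = (e ω'.1).2 → past (c.obs ω) i = past (c.obs ω') i →
      f (c.X ω i) = f (c.X ω' i)) :
    logb 2 (Fintype.card γ) ≤ 1 + errorProb W c * logb 2 (Fintype.card γ) +
      ∑ i, (condEntropy (sampleProb W c) (fun ω => (ω.2 i).Y₃) (fun ω => f (c.X ω i)) -
        condEntropy (sampleProb W c) (fun ω => (ω.2 i).Y₃) (c.X · i)) := by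
  have hp := sampleProb_mem_stdSimplex W c
  have := Fintype.ofFinite β
  refine (logb_card_le_add_sum W c e id c.obs (fun y => g fun i => (y i).1) hg).trans ?_
  gcongr 1 + _ * _ + ∑ i, ?_ with i
  have hupper : condEntropy (sampleProb W c) (c.obs · i)
      (fun ω => ((e ω.1).2, past (c.obs ω) i)) ≤
        condEntropy (sampleProb W c) (fun ω => (ω.2 i).Y₃) (fun ω => f (c.X ω i)) +
          entropy W.noiseLaw id := by
    rw [← (hasCondLaw_noise W c i).entropy_comp_eq hp id]
    simp only [Code.obs_eq]
    rw [condEntropy_prodMk]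
    refine add_le_add (condEntropy_anti hp.1 _ fun ω ω' h => ?_) (condEntropy_le_entropy hp _ _)
    exact hf i ω ω' (Prod.mk.inj h).1 (Prod.mk.inj h).2
  have hlower : condEntropy (sampleProb W c) (c.obs · i)
      (fun ω => (((e ω.1).1, (e ω.1).2), past (c.obs ω) i)) =
        condEntropy (sampleProb W c) (fun ω => (ω.2 i).Y₃) (c.X · i) + entropy W.noiseLaw id := by
    rw [← condEntropy_obs_history]
    exact condEntropy_congr (fun ω ω' => by simp [Code.history_eq_iff (c := c)])
      fun _ _ _ => Iff.rfl
  simp only [id]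
  linarith

lemma condEntropy_Y₁₂_history (i : Fin n) :
    condEntropy (sampleProb W c) (fun ω => ((ω.2 i).Y₁, (ω.2 i).Y₂)) (history i) =
      entropy W.PZ1 id + entropy W.PZ2 id := by
  rw [← entropy_prodLaw W.PZ1_mem W.PZ2_mem]
  refine .trans ?_ ((hasCondLaw_noise W c i).condEntropy_comp_eq
    (sampleProb_mem_stdSimplex W c) id id)
  refine condEntropy_congr (fun _ _ => Iff.rfl) fun ω ω' h => ?_
  have hX₃ : c.X₃ ω i = c.X₃ ω' i := congrArg (c.input₃ i) h
  simp only [id, Prod.mk.injEq, c.recv_eq_iff_of_auxVar_eq (auxVar_congr_history h), hX₃,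
    add_right_inj]

/-- User 1 is given the output of user 2. Then `Z₂` contributes equally to both entropies of the
pair of outputs, and what remains depends on `X₃ + Z₁` only. -/
lemma broadcast_converse₁ :
    logb 2 (Fintype.card (Msg n R₃₁)) ≤ 1 + errorProb W c * logb 2 (Fintype.card (Msg n R₃₁)) +
      ∑ i, (condEntropy (sampleProb W c) (fun ω => c.X₃ ω i + c.Z₁ ω i) (auxVar i) -
        condEntropy (sampleProb W c) (fun ω => c.X₃ ω i + c.Z₁ ω i)
          (fun ω => (c.X₃ ω i, auxVar i ω))) := by
  have hp := sampleProb_mem_stdSimplex W c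
  refine (logb_card_le_add_sum W c
    (e := ⟨fun m => (m.M₃₁, m.M₁₃, m.M₂₃, m.M₃₂), fun x => ⟨x.2.1, x.2.2.1, x.1, x.2.2.2⟩,
      fun _ => rfl, fun _ => rfl⟩) id (fun ω i => ((ω.2 i).Y₁, (ω.2 i).Y₂))
    (fun y m => c.g₁ m.1 fun i => (y i).1) fun ω hω => .inr (.inr (.inl (Ne.symm hω)))).trans ?_
  gcongr 1 + _ * _ + ∑ i, ?_ with i
  have hupper : condEntropy (sampleProb W c) (fun ω => ((ω.2 i).Y₁, (ω.2 i).Y₂)) (auxVar i) ≤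
      condEntropy (sampleProb W c) (fun ω => c.X₃ ω i + c.Z₁ ω i) (auxVar i) +
        entropy W.PZ2 id := by
    rw [condEntropy_congr (Y := fun ω => (c.X₃ ω i + c.Z₁ ω i, c.Z₂ ω i)) (fun _ _ => Iff.rfl)
      fun ω ω' h => by simpa only [Prod.mk.injEq] using c.recv_eq_iff_of_auxVar_eq h,
      condEntropy_prodMk, ← (hasCondLaw_Z₂ W c i).entropy_comp_eq hp id]
    gcongr
    exact condEntropy_le_entropy hp _ _
  have hlower : entropy W.PZ1 id + entropy W.PZ2 id ≤
      condEntropy (sampleProb W c) (fun ω => ((ω.2 i).Y₁, (ω.2 i).Y₂))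
        (fun ω => ((ω.1.M₃₁, ω.1.M₁₃, ω.1.M₂₃, ω.1.M₃₂),
          past (fun j => ((ω.2 j).Y₁, (ω.2 j).Y₂)) i)) := by
    rw [← condEntropy_Y₁₂_history W c i]
    refine condEntropy_anti hp.1 _ fun ω ω' h => ?_
    obtain ⟨hm, hpast⟩ := Prod.mk.inj h
    simp only [hm, Prod.mk.injEq, past_eq_iff, true_and]
    exact fun j hj => by simp only [past_eq_iff.1 hpast j hj, and_self]
  have hnoise : condEntropy (sampleProb W c) (fun ω => c.X₃ ω i + c.Z₁ ω i)
      (fun ω => (c.X₃ ω i, auxVar i ω)) = entropy W.PZ1 id := by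
    rw [← (hasCondLaw_Z₁ W c i).condEntropy_comp_eq hp id fun h =>
      (c.input₃ i h, (h.1.M₁₃, h.1.M₂₃, h.1.M₃₂), fun j => ((h.2 j).Y₁, (h.2 j).Y₂))]
    refine condEntropy_congr (fun _ _ => Iff.rfl) fun ω ω' h => ?_
    rw [(Prod.mk.inj h).1, add_right_inj, id, id]
  linarith!

lemma broadcast_converse₂ :
    logb 2 (Fintype.card (Msg n R₃₂)) ≤ 1 + errorProb W c * logb 2 (Fintype.card (Msg n R₃₂)) +
      ∑ i, (entropy (sampleProb W c) (fun ω => c.X₃ ω i + c.Z₁ ω i + c.Z₂ ω i) -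
        condEntropy (sampleProb W c) (fun ω => c.X₃ ω i + c.Z₁ ω i + c.Z₂ ω i) (auxVar i)) := by
  have hp := sampleProb_mem_stdSimplex W c
  refine (logb_card_le_add_sum W c
    (e := ⟨fun m => (m.M₃₂, m.M₂₃, m.M₁₃, m.M₃₁), fun x => ⟨x.2.2.1, x.2.1, x.2.2.2, x.1⟩,
      fun _ => rfl, fun _ => rfl⟩) (k := Prod.fst) (fun ω i => (ω.2 i).Y₂)
    (fun y m => c.g₂ m y) fun ω hω => .inr (.inr (.inr (Ne.symm hω)))).trans ?_
  gcongr 1 + _ * _ + ∑ i, (?_ - ?_) with i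
  · refine (condEntropy_congr (Y := fun ω => c.X₃ ω i + c.Z₁ ω i + c.Z₂ ω i)
      (fun _ _ => Iff.rfl) fun ω ω' h => ?_).trans_le (condEntropy_le_entropy hp _ _)
    obtain ⟨hm, hpast⟩ := Prod.mk.inj h
    rw [Code.Y₂_eq (c := c), Code.Y₂_eq (c := c), Code.X₂_congr hm (past_eq_iff.1 hpast),
      add_right_inj]
  · rw [condEntropy_congr (Y := fun ω => (ω.2 i).Y₂) (T := auxVar i) (fun _ _ => Iff.rfl)
      fun ω ω' h => by rw [Code.Y₂_eq (c := c), Code.Y₂_eq (c := c), Code.X₂_congr_auxVar h,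
        add_right_inj]]
    refine condEntropy_anti hp.1 _ fun ω ω' h => ?_
    obtain ⟨⟨-, hm, hm'⟩, hpast⟩ := auxVar_eq_iff.1 h
    exact Prod.ext (Prod.ext hm' hm) (past_eq_iff.2 fun j hj => (hpast j hj).2)

end Converse

section TimeSharing

variable {Ω α β τ : Type*} [Fintype Ω] {p : Ω → ℝ} {n : ℕ}

/-- The joint law of a uniformly distributed time index and an independent outcome. -/
noncomputable def timeShare (n : ℕ) (p : Ω → ℝ) : Fin n × Ω → ℝ := prodLaw (fun _ => (n : ℝ)⁻¹) p

lemma timeShare_mem_stdSimplex [NeZero n] (hp : p ∈ stdSimplex ℝ Ω) :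
    timeShare n p ∈ stdSimplex ℝ (Fin n × Ω) :=
  prodLaw_mem_stdSimplex ⟨fun _ => by positivity, by simp [NeZero.ne n]⟩ hp

lemma sum_timeShare_mul (p : Ω → ℝ) (F : Fin n × Ω → ℝ) :
    ∑ x, timeShare n p x * F x = (n : ℝ)⁻¹ * ∑ i, ∑ ω, p ω * F (i, ω) := by
  simp only [Fintype.sum_prod_type, timeShare, prodLaw, mul_assoc, ← mul_sum]

lemma law_timeShare {X : Fin n × Ω → α} {a : α} {Y : Ω → β} {b : β} {i : Fin n}
    (h : ∀ j ω, X (j, ω) = a ↔ j = i ∧ Y ω = b) :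
    law (timeShare n p) X a = (n : ℝ)⁻¹ * law p Y b := by
  classical
  calc law (timeShare n p) X a = ∑ x, timeShare n p x * if X x = a then 1 else 0 := by simp [law]
    _ = _ := by
      rw [sum_timeShare_mul]
      simp [law, h, ite_and, sum_ite_irrel]

lemma sum_condEntropy_eq [NeZero n] [Fintype α] {𝒱 : Fin n → Type*} [∀ i, Fintype (𝒱 i)]
    (hp : p ∈ stdSimplex ℝ Ω) (X : Fin n → Ω → α) (V : (i : Fin n) → Ω → 𝒱 i) :
    ∑ i, condEntropy p (X i) (V i) =
      n * condEntropy (timeShare n p) (fun x => X x.1 x.2)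
        (fun x => (⟨x.1, V x.1 x.2⟩ : Σ i, 𝒱 i)) := by
  have hn : (n : ℝ)⁻¹ ≠ 0 := inv_ne_zero (NeZero.ne _)
  have hlaw : ∀ i v, law (timeShare n p) (fun x => (⟨x.1, V x.1 x.2⟩ : Σ i, 𝒱 i)) ⟨i, v⟩ =
      (n : ℝ)⁻¹ * law p (V i) v := fun i v => law_timeShare fun j ω => by
    simp only [Sigma.mk.injEq]
    exact and_congr_right fun h => by subst h; exact heq_iff_eq
  have hlaw' : ∀ i a v, law (timeShare n p)
      (fun x => (X x.1 x.2, (⟨x.1, V x.1 x.2⟩ : Σ i, 𝒱 i))) (a, ⟨i, v⟩) =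
        (n : ℝ)⁻¹ * law p (fun ω => (X i ω, V i ω)) (a, v) := by
    refine fun i a v => law_timeShare (i := i) fun j ω => ?_
    simp only [Prod.mk.injEq, Sigma.mk.injEq, and_left_comm (a := X j ω = a)]
    exact and_congr_right fun h => by subst h; simp only [heq_eq_eq]
  simp only [condEntropy_eq_sum (timeShare_mem_stdSimplex hp).1, condEntropy_eq_sum hp.1,
    sum_timeShare_mul, hlaw, hlaw', mul_div_mul_left _ _ hn, sum_neg_distrib]
  rw [← mul_neg, mul_inv_cancel_left₀ (NeZero.ne _)]

lemma sum_condMutualInfo_eq [NeZero n] [Fintype α] [Fintype β] {𝒱 : Fin n → Type*}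
    [∀ i, Fintype (𝒱 i)] (hp : p ∈ stdSimplex ℝ Ω) (X : Fin n → Ω → α) (Y : Fin n → Ω → β)
    (V : (i : Fin n) → Ω → 𝒱 i) :
    ∑ i, condMutualInfo p (X i) (Y i) (V i) =
      n * condMutualInfo (timeShare n p) (fun x => X x.1 x.2) (fun x => Y x.1 x.2)
        (fun x => (⟨x.1, V x.1 x.2⟩ : Σ i, 𝒱 i)) := by
  simp only [condMutualInfo, eq_sub_of_add_eq' (condEntropy_prodMk _ _ _).symm, sum_sub_distrib,
    sum_condEntropy_eq hp]
  ring

lemma sum_condEntropy_le [NeZero n] [Fintype α] [Fintype β] (hp : p ∈ stdSimplex ℝ Ω)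
    (X : Fin n → Ω → α) (Y : Fin n → Ω → β) :
    ∑ i, condEntropy p (X i) (Y i) ≤
      n * condEntropy (timeShare n p) (fun x => X x.1 x.2) (fun x => Y x.1 x.2) := by
  rw [sum_condEntropy_eq hp]
  gcongr
  refine condEntropy_anti (timeShare_mem_stdSimplex hp).1 _ fun x x' h => ?_
  exact eq_of_heq (Sigma.mk.inj h).2

lemma sum_entropy_le [NeZero n] [Fintype α] (hp : p ∈ stdSimplex ℝ Ω) (X : Fin n → Ω → α) :
    ∑ i, entropy p (X i) ≤ n * entropy (timeShare n p) (fun x => X x.1 x.2) := by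
  simpa only [condEntropy_of_subsingleton hp.2,
    condEntropy_of_subsingleton (timeShare_mem_stdSimplex hp).2] using
      sum_condEntropy_le hp X fun _ _ => ()

lemma HasCondLaw.timeShare [Fintype τ] {A : Fin n → Ω → α} {T : Fin n → Ω → τ} {κ : α → τ → ℝ}
    (h : ∀ i, HasCondLaw p (A i) (T i) κ) :
    HasCondLaw (timeShare n p) (fun x => A x.1 x.2) (fun x => T x.1 x.2) κ := by
  intro G
  simp only [sum_timeShare_mul, h _ G]

lemma HasCondLaw.sum_condEntropy_eq [NeZero n] [Fintype α] [Fintype τ] (hp : p ∈ stdSimplex ℝ Ω)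
    {A : Fin n → Ω → α} {T : Fin n → Ω → τ} {κ : α → τ → ℝ}
    (h : ∀ i, HasCondLaw p (A i) (T i) κ) :
    ∑ i, condEntropy p (T i) (A i) =
      n * condEntropy (MADB.timeShare n p) (fun x => T x.1 x.2) (fun x => A x.1 x.2) := by
  rw [(HasCondLaw.timeShare h).condEntropy_eq (timeShare_mem_stdSimplex hp).1, sum_timeShare_mul,
    mul_inv_cancel_left₀ (NeZero.ne _)]
  exact sum_congr rfl fun i _ => (h i).condEntropy_eq hp.1

end TimeSharing

section SingleLetter

variable {q : ℕ} [NeZero q] {𝒴 : Type*} [Fintype 𝒴] {n : ℕ} {R₁₃ R₂₃ R₃₁ R₃₂ : ℝ}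
  (W : Channel q 𝒴) (c : Code q 𝒴 n R₁₃ R₂₃ R₃₁ R₃₂)

/-- The alphabet of the auxiliary variable at a random time, which includes the time. -/
abbrev AuxAlphabet (q n : ℕ) (R₁₃ R₂₃ R₃₂ : ℝ) : Type :=
  Σ i : Fin n, (Msg n R₁₃ × Msg n R₂₃ × Msg n R₃₂) × (Fin (i : ℕ) → ZMod q × ZMod q)

/-- The inputs and the auxiliary variable at time `x.1`. -/
def Code.inputAux (x : Fin n × Sample q 𝒴 n R₁₃ R₂₃ R₃₁ R₃₂) :
    ZMod q × ZMod q × ZMod q × AuxAlphabet q n R₁₃ R₂₃ R₃₂ :=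
  (c.X₁ x.2 x.1, c.X₂ x.2 x.1, c.X₃ x.2 x.1, ⟨x.1, auxVar x.1 x.2⟩)

/-- The inputs, the auxiliary variable and the channel noise at time `x.1`. -/
def Code.outcome (x : Fin n × Sample q 𝒴 n R₁₃ R₂₃ R₃₁ R₃₂) :
    Outcome q 𝒴 (AuxAlphabet q n R₁₃ R₂₃ R₃₂) :=
  ⟨c.X₁ x.2 x.1, c.X₂ x.2 x.1, c.X₃ x.2 x.1, ⟨x.1, auxVar x.1 x.2⟩, (x.2.2 x.1).Y₃,
    c.Z₁ x.2 x.1, c.Z₂ x.2 x.1⟩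

/-- The joint law of the inputs and the auxiliary variable at a uniformly distributed time. -/
noncomputable def inputAuxLaw :
    ZMod q × ZMod q × ZMod q × AuxAlphabet q n R₁₃ R₂₃ R₃₂ → ℝ :=
  law (timeShare n (sampleProb W c)) c.inputAux

lemma law_outcome :
    law (timeShare n (sampleProb W c)) c.outcome = W.outcomeProb (inputAuxLaw W c) := by
  have hcond : HasCondLaw (timeShare n (sampleProb W c)) c.inputAux (fun x => c.obs x.2 x.1)
      fun a => W.kernel a.1 a.2.1 a.2.2.1 :=
    HasCondLaw.timeShare (A := fun i ω => c.inputAux (i, ω)) fun i =>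
      (hasCondLaw_obs W c i).comp (κ := fun a : _ × _ × _ × AuxAlphabet q n R₁₃ R₂₃ R₃₂ =>
        W.kernel a.1 a.2.1 a.2.2.1) (g := fun h => (c.input₁ i h, c.input₂ i h, c.input₃ i h,
          ⟨i, (h.1.M₁₃, h.1.M₂₃, h.1.M₃₂), fun j => ((h.2 j).Y₁, (h.2 j).Y₂)⟩))
  funext o
  have hlaw := hcond.law_prodMk (o.Y₃, o.Z₁, o.Z₂) (o.X₁, o.X₂, o.X₃, o.V)
  rw [Channel.outcomeProb, mul_assoc, mul_assoc]
  refine (law_congr fun x => ?_).trans hlaw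
  obtain ⟨X₁, X₂, X₃, V, Y₃, Z₁, Z₂⟩ := o
  simp only [Code.outcome, Code.inputAux, Code.obs_eq, Outcome.mk.injEq, Prod.mk.injEq]
  tauto

lemma inputAuxLaw_mem_stdSimplex [NeZero n] [Nonempty (Messages n R₁₃ R₂₃ R₃₁ R₃₂)] :
    inputAuxLaw W c ∈
      stdSimplex ℝ (ZMod q × ZMod q × ZMod q × AuxAlphabet q n R₁₃ R₂₃ R₃₂) :=
  law_mem_stdSimplex (timeShare_mem_stdSimplex (sampleProb_mem_stdSimplex W c)) _

variable [NeZero n] [Nonempty (Messages n R₁₃ R₂₃ R₃₁ R₃₂)] {β γ δ σ : Type*} [Finite β] [Fintype γ]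
  [Fintype δ] [Fintype σ]

lemma mac_single_letter (e : Messages n R₁₃ R₂₃ R₃₁ R₃₂ ≃ γ × β) (g : (Fin n → 𝒴) → β → γ)
    (hg : {ω | (e ω.1).1 ≠ g (fun i => (ω.2 i).Y₃) (e ω.1).2} ⊆ c.errorEvent)
    (s : ZMod q × ZMod q × ZMod q → σ) (f : ZMod q × ZMod q × ZMod q → δ)
    (hsf : Function.Injective fun x => (s x, f x))
    (hf : ∀ (i : Fin n) ω ω', (e ω.1).2 = (e ω'.1).2 → past (c.obs ω) i = past (c.obs ω') i →
      f (c.X ω i) = f (c.X ω' i)) :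
    (1 - errorProb W c) * logb 2 (Fintype.card γ) - 1 ≤
      n * condMutualInfo (W.outcomeProb (inputAuxLaw W c)) (fun o => s (o.X₁, o.X₂, o.X₃)) (·.Y₃)
        (fun o => f (o.X₁, o.X₂, o.X₃)) := by
  have hp := sampleProb_mem_stdSimplex W c
  have hconv := mac_converse W c e g hg f hf
  have hinput := HasCondLaw.sum_condEntropy_eq hp (hasCondLaw_Y₃ W c)
  have hpart := sum_condEntropy_le hp (fun i ω => (ω.2 i).Y₃) fun i ω => f (c.X ω i)
  have hall : condEntropy (timeShare n (sampleProb W c)) (fun x => (x.2.2 x.1).Y₃)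
      (fun x => (s (c.X x.2 x.1), f (c.X x.2 x.1))) =
        condEntropy (timeShare n (sampleProb W c)) (fun x => (x.2.2 x.1).Y₃)
          (fun x => c.X x.2 x.1) :=
    condEntropy_congr (fun _ _ => hsf.eq_iff) fun _ _ _ => Iff.rfl
  rw [sum_sub_distrib, hinput, ← hall] at hconv
  rw [condMutualInfo_eq, ← law_outcome, condEntropy_law, condEntropy_law]
  simp only [Code.outcome]
  linarith!

lemma mac_single_letter₁ :
    (1 - errorProb W c) * logb 2 (Fintype.card (Msg n R₁₃)) - 1 ≤
      n * condMutualInfo (W.outcomeProb (inputAuxLaw W c)) (·.X₁) (·.Y₃)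
        (fun o => (o.X₂, o.X₃)) :=
  mac_single_letter W c
    (e := ⟨fun m => (m.M₁₃, m.M₂₃, m.M₃₁, m.M₃₂), fun x => ⟨x.1, x.2.1, x.2.2.1, x.2.2.2⟩,
      fun _ => rfl, fun _ => rfl⟩)
    (fun y m => (c.g₃ m.2.1 m.2.2 y).1) (fun _ hω => .inl (Ne.symm hω)) Prod.fst Prod.snd
    (fun _ _ h => h) fun i ω ω' hm h => by
      obtain ⟨h₂₃, hm₃⟩ := Prod.mk.inj hm
      obtain ⟨h₃₁, h₃₂⟩ := Prod.mk.inj hm₃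
      exact Prod.ext (Code.X₂_congr_obs h₂₃ h₃₁ h₃₂ h) (Code.X₃_congr_obs h₃₁ h₃₂ h)

lemma mac_single_letter₂ :
    (1 - errorProb W c) * logb 2 (Fintype.card (Msg n R₂₃)) - 1 ≤
      n * condMutualInfo (W.outcomeProb (inputAuxLaw W c)) (·.X₂) (·.Y₃)
        (fun o => (o.X₁, o.X₃)) :=
  mac_single_letter W c
    (e := ⟨fun m => (m.M₂₃, m.M₁₃, m.M₃₁, m.M₃₂), fun x => ⟨x.2.1, x.1, x.2.2.1, x.2.2.2⟩,
      fun _ => rfl, fun _ => rfl⟩)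
    (fun y m => (c.g₃ m.2.1 m.2.2 y).2) (fun _ hω => .inr (.inl (Ne.symm hω)))
    (fun x => x.2.1) (fun x => (x.1, x.2.2)) (fun x x' h => by simp_all [Prod.ext_iff])
    fun i ω ω' hm h => by
      obtain ⟨h₁₃, hm₃⟩ := Prod.mk.inj hm
      obtain ⟨h₃₁, h₃₂⟩ := Prod.mk.inj hm₃
      exact Prod.ext (Code.X₁_congr_obs h₁₃ h₃₁ h₃₂ h) (Code.X₃_congr_obs h₃₁ h₃₂ h)

lemma mac_single_letter₁₂ :
    (1 - errorProb W c) * logb 2 (Fintype.card (Msg n R₁₃ × Msg n R₂₃)) - 1 ≤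
      n * condMutualInfo (W.outcomeProb (inputAuxLaw W c)) (fun o => (o.X₁, o.X₂)) (·.Y₃) (·.X₃) :=
  mac_single_letter W c
    (e := ⟨fun m => ((m.M₁₃, m.M₂₃), m.M₃₁, m.M₃₂), fun x => ⟨x.1.1, x.1.2, x.2.1, x.2.2⟩,
      fun _ => rfl, fun _ => rfl⟩)
    (fun y m => c.g₃ m.1 m.2 y)
    (fun ω hω => by
      by_contra h
      simp only [Code.errorEvent, Set.mem_ofPred_eq, not_or, not_not] at h
      exact hω (Prod.ext h.1.symm h.2.1.symm))
    (fun x => (x.1, x.2.1)) (fun x => x.2.2) (fun x x' h => by simp_all [Prod.ext_iff])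
    fun i ω ω' hm h => Code.X₃_congr_obs (Prod.mk.inj hm).1 (Prod.mk.inj hm).2 h

lemma broadcast_single_letter₁ :
    (1 - errorProb W c) * logb 2 (Fintype.card (Msg n R₃₁)) - 1 ≤
      n * condMutualInfo (W.outcomeProb (inputAuxLaw W c)) (·.X₃) (fun o => o.X₃ + o.Z₁)
        (·.V) := by
  have hp := sampleProb_mem_stdSimplex W c
  have hconv := broadcast_converse₁ W c
  have hinfo := sum_condMutualInfo_eq hp (fun i ω => c.X₃ ω i) (fun i ω => c.X₃ ω i + c.Z₁ ω i)
    auxVar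
  simp only [condMutualInfo_eq] at hinfo
  rw [hinfo] at hconv
  rw [condMutualInfo_eq, ← law_outcome, condEntropy_law, condEntropy_law]
  simp only [Code.outcome]
  linarith!

lemma broadcast_single_letter₂ :
    (1 - errorProb W c) * logb 2 (Fintype.card (Msg n R₃₂)) - 1 ≤
      n * mutualInfo (W.outcomeProb (inputAuxLaw W c)) (·.V) (fun o => o.X₃ + o.Z₁ + o.Z₂) := by
  have hp := sampleProb_mem_stdSimplex W c
  have hconv := broadcast_converse₂ W c
  have hout := sum_entropy_le hp fun i ω => c.X₃ ω i + c.Z₁ ω i + c.Z₂ ω i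
  rw [sum_sub_distrib, sum_condEntropy_eq hp] at hconv
  rw [mutualInfo_eq, ← law_outcome, entropy_law, condEntropy_law]
  simp only [Code.outcome]
  linarith!

end SingleLetter

section ConicCaratheodory

variable {ι E : Type*} [AddCommGroup E] [Module ℝ E] {A : ι → E} {d w : ι → ℝ}

lemma exists_dependency_of_finrank_lt [Fintype ι] [FiniteDimensional ℝ E] {s : Finset ι}
    (h : Module.finrank ℝ E < #s) (A : ι → E) (g : ι → ℝ) :
    ∃ d : ι → ℝ, (∀ i ∉ s, d i = 0) ∧ d ≠ 0 ∧ ∑ i, d i • A i = 0 ∧ ∑ i, d i * g i ≤ 0 := by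
  classical
  have hdep : ¬ LinearIndepOn ℝ A s := fun hA =>
    h.not_ge (by simpa using LinearIndependent.fintype_card_le_finrank hA)
  rw [linearIndepOn_finset_iff] at hdep
  push Not at hdep
  obtain ⟨f, hf, i, hi, hfi⟩ := hdep
  let d := (s : Set ι).indicator f
  have hd : ∀ j ∉ s, d j = 0 := fun j hj => Set.indicator_of_notMem (mem_coe.not.2 hj) f
  have hd0 : d ≠ 0 := fun h0 => hfi (by simpa [d, hi] using congrFun h0 i)
  have hdA : ∑ j, d j • A j = 0 := by
    rw [← hf, ← sum_subset (subset_univ s) fun j _ hj => by simp [hd j hj]]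
    exact sum_congr rfl fun j hj => by simp [d, hj]
  rcases le_total (∑ j, d j * g j) 0 with hg | hg
  · exact ⟨d, hd, hd0, hdA, hg⟩
  · exact ⟨-d, fun j hj => by simp [hd j hj], neg_ne_zero.2 hd0, by simp [hdA], by simpa using hg⟩

lemma exists_neg_of_sum_smul_eq_zero [Fintype ι] (hd : ∑ i, d i • A i = 0) (hd0 : d ≠ 0)
    (φ : E →ₗ[ℝ] ℝ) (hφ : ∀ i, 0 < φ (A i)) : ∃ i, d i < 0 := by
  by_contra! h
  have hsum : ∑ i, d i * φ (A i) = 0 := by simpa using congrArg φ hd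
  rw [sum_eq_zero_iff_of_nonneg fun i _ => mul_nonneg (h i) (hφ i).le] at hsum
  exact hd0 (funext fun i => (mul_eq_zero_iff_right (hφ i).ne').1 (hsum i (mem_univ i)))

lemma exists_add_mul_eq_zero [Finite ι] (hw : ∀ i, 0 ≤ w i) (hd : ∃ i, d i < 0) :
    ∃ t, 0 ≤ t ∧ (∀ i, 0 ≤ w i + t * d i) ∧ ∃ i, d i < 0 ∧ w i + t * d i = 0 := by
  classical
  have := Fintype.ofFinite ι
  obtain ⟨i, hi, hmin⟩ := exists_min_image ({i | d i < 0} : Finset ι) (fun i => w i / -d i)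
    (hd.imp fun i => by simp)
  simp only [mem_filter, mem_univ, true_and] at hi hmin
  refine ⟨w i / -d i, div_nonneg (hw i) (neg_pos.2 hi).le, fun j => ?_, i, hi, ?_⟩
  · rcases le_or_gt 0 (d j) with h | h
    · exact add_nonneg (hw j) (mul_nonneg (div_nonneg (hw i) (neg_pos.2 hi).le) h)
    · have := (le_div_iff₀ (neg_pos.2 h)).1 (hmin j h)
      linarith
  · rw [div_neg, neg_mul, div_mul_cancel₀ _ hi.ne, add_neg_cancel]

lemma exists_support_ssubset [Fintype ι] [FiniteDimensional ℝ E] (A : ι → E)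
    (φ : E →ₗ[ℝ] ℝ) (hφ : ∀ i, 0 < φ (A i)) (g : ι → ℝ) (hw : ∀ i, 0 ≤ w i)
    (hcard : Module.finrank ℝ E < w.support.ncard) :
    ∃ w' : ι → ℝ, (∀ i, 0 ≤ w' i) ∧ w'.support ⊂ w.support ∧
      ∑ i, w' i • A i = ∑ i, w i • A i ∧ ∑ i, w' i * g i ≤ ∑ i, w i * g i := by
  classical
  rw [Set.ncard_eq_toFinset_card'] at hcard
  obtain ⟨d, hds, hd0, hdA, hdg⟩ := exists_dependency_of_finrank_lt hcard A g
  have hdw : ∀ i, w i = 0 → d i = 0 := fun i hi => hds i (by simpa using hi)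
  obtain ⟨t, ht, hnonneg, i, hi, hzero⟩ :=
    exists_add_mul_eq_zero hw (exists_neg_of_sum_smul_eq_zero hdA hd0 φ hφ)
  refine ⟨fun j => w j + t * d j, hnonneg, ?_, ?_, ?_⟩
  · refine (Set.ssubset_iff_of_subset fun j hj => ?_).2
      ⟨i, fun hwi => hi.ne (hdw i hwi), by simpa using hzero⟩
    rw [Function.mem_support] at hj ⊢
    exact fun hwj => hj (by simp [hwj, hdw j hwj])
  · simp only [add_smul, mul_smul, sum_add_distrib, ← smul_sum, hdA, smul_zero, add_zero]
  · simp only [add_mul, mul_assoc, sum_add_distrib, ← mul_sum]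
    exact add_le_of_nonpos_right (mul_nonpos_of_nonneg_of_nonpos ht hdg)

lemma exists_support_ncard_le_finrank [Fintype ι] [FiniteDimensional ℝ E] (A : ι → E)
    (φ : E →ₗ[ℝ] ℝ) (hφ : ∀ i, 0 < φ (A i)) (g : ι → ℝ) (hw : ∀ i, 0 ≤ w i) :
    ∃ w' : ι → ℝ, (∀ i, 0 ≤ w' i) ∧ w'.support.ncard ≤ Module.finrank ℝ E ∧
      ∑ i, w' i • A i = ∑ i, w i • A i ∧ ∑ i, w' i * g i ≤ ∑ i, w i * g i := by
  induction hc : w.support.ncard using Nat.strong_induction_on generalizing w with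
  | _ m ih =>
    rcases le_or_gt m (Module.finrank ℝ E) with hm | hm
    · exact ⟨w, hw, hc.trans_le hm, rfl, le_rfl⟩
    obtain ⟨w₁, hw₁, hsupp, hA₁, hg₁⟩ := exists_support_ssubset A φ hφ g hw (hm.trans_eq hc.symm)
    obtain ⟨w₂, hw₂, hcard, hA₂, hg₂⟩ :=
      ih _ (hc ▸ Set.ncard_lt_ncard hsupp (Set.toFinite _)) hw₁ rfl
    exact ⟨w₂, hw₂, hcard, hA₂.trans hA₁, hg₂.trans hg₁⟩

lemma sum_equivFin_symm {M : Type*} [AddCommMonoid M] (s : Finset ι) (f : ι → M) :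
    ∑ j, f (s.equivFin.symm j) = ∑ i ∈ s, f i := by
  rw [s.equivFin.symm.sum_comp fun i : s => f i, sum_coe_sort]

lemma exists_fin_conic_combination [Fintype ι] [FiniteDimensional ℝ E] (A : ι → E)
    (φ : E →ₗ[ℝ] ℝ) (hφ : ∀ i, 0 < φ (A i)) (g : ι → ℝ) (hw : ∀ i, 0 ≤ w i) :
    ∃ k ≤ Module.finrank ℝ E, ∃ (u : Fin k → ι) (w' : Fin k → ℝ), (∀ j, 0 ≤ w' j) ∧
      ∑ j, w' j • A (u j) = ∑ i, w i • A i ∧ ∑ j, w' j * g (u j) ≤ ∑ i, w i * g i := by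
  classical
  obtain ⟨w', hw', hcard, hA, hg⟩ := exists_support_ncard_le_finrank A φ hφ g hw
  rw [Set.ncard_eq_toFinset_card'] at hcard
  let s := w'.support.toFinset
  have hs : ∀ i ∉ s, w' i = 0 := fun i hi => by simpa [s] using hi
  refine ⟨#s, hcard, fun j => s.equivFin.symm j, fun j => w' (s.equivFin.symm j),
    fun j => hw' _, ?_, ?_⟩
  · rw [sum_equivFin_symm s fun i => w' i • A i, ← hA]
    exact sum_subset (subset_univ s) fun i _ hi => by rw [hs i hi, zero_smul]
  · rw [sum_equivFin_symm s fun i => w' i * g i]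
    refine le_of_eq_of_le (sum_subset (subset_univ s) fun i _ hi => ?_) hg
    rw [hs i hi, zero_mul]

end ConicCaratheodory

section OutcomeLaw

variable {q : ℕ} [NeZero q] {𝒴 𝒱 𝒱' : Type*} [Fintype 𝒴] [Fintype 𝒱] [Fintype 𝒱']
  (W : Channel q 𝒴) {P : ZMod q × ZMod q × ZMod q × 𝒱 → ℝ}
  {P' : ZMod q × ZMod q × ZMod q × 𝒱' → ℝ}

lemma sum_outcomeProb_mul (P : ZMod q × ZMod q × ZMod q × 𝒱 → ℝ) (F : Outcome q 𝒴 𝒱 → ℝ) :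
    ∑ o, W.outcomeProb P o * F o =
      ∑ a, P a * ∑ t, W.kernel a.1 a.2.1 a.2.2.1 t *
        F ⟨a.1, a.2.1, a.2.2.1, a.2.2.2, t.1, t.2.1, t.2.2⟩ := by
  rw [← (Outcome.equivProd q 𝒴 𝒱).symm.sum_comp]
  simp only [Fintype.sum_prod_type, mul_sum]
  refine sum_congr rfl fun x₁ _ => sum_congr rfl fun x₂ _ => sum_congr rfl fun x₃ _ =>
    sum_congr rfl fun v _ => sum_congr rfl fun y _ => sum_congr rfl fun z₁ _ =>
    sum_congr rfl fun z₂ _ => ?_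
  simp only [Channel.outcomeProb, Channel.kernel, Channel.noiseLaw, prodLaw, Outcome.equivProd,
    Equiv.coe_fn_symm_mk]
  ring

lemma sum_outcomeProb_mul_input (P : ZMod q × ZMod q × ZMod q × 𝒱 → ℝ)
    (F : ZMod q × ZMod q × ZMod q × 𝒱 → ℝ) :
    ∑ o, W.outcomeProb P o * F (o.X₁, o.X₂, o.X₃, o.V) = ∑ a, P a * F a := by
  simp only [sum_outcomeProb_mul, ← sum_mul, (W.kernel_mem_stdSimplex _ _ _).2, one_mul]

lemma outcomeProb_mem_stdSimplex (hP : P ∈ stdSimplex ℝ (ZMod q × ZMod q × ZMod q × 𝒱)) :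
    W.outcomeProb P ∈ stdSimplex ℝ (Outcome q 𝒴 𝒱) :=
  ⟨fun _ => mul_nonneg (mul_nonneg (mul_nonneg (hP.1 _) ((W.PY3_mem _ _ _).1 _)) (W.PZ1_mem.1 _))
    (W.PZ2_mem.1 _), by simpa [hP.2] using sum_outcomeProb_mul_input W P fun _ => 1⟩

lemma law_outcomeProb_input (P : ZMod q × ZMod q × ZMod q × 𝒱 → ℝ) :
    law (W.outcomeProb P) (fun o => (o.X₁, o.X₂, o.X₃, o.V)) = P := by
  classical
  ext a
  simpa [Pi.single_apply] using (sum_law_mul (W.outcomeProb P)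
    (fun o => (o.X₁, o.X₂, o.X₃, o.V)) (Pi.single a 1)).trans
      (sum_outcomeProb_mul_input W P (Pi.single a 1))

lemma hasCondLaw_outcome_output (P : ZMod q × ZMod q × ZMod q × 𝒱 → ℝ) :
    HasCondLaw (W.outcomeProb P) (fun o => (o.X₁, o.X₂, o.X₃, o.V))
      (fun o => (o.Y₃, o.Z₁, o.Z₂)) fun a => W.kernel a.1 a.2.1 a.2.2.1 := by
  intro G
  rw [sum_outcomeProb_mul_input W P fun a => ∑ t, W.kernel a.1 a.2.1 a.2.2.1 t * G a t,
    sum_outcomeProb_mul]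

lemma hasCondLaw_outcome_noise (P : ZMod q × ZMod q × ZMod q × 𝒱 → ℝ) :
    HasCondLaw (W.outcomeProb P) (fun o => (o.X₁, o.X₂, o.X₃, o.V)) (fun o => (o.Z₁, o.Z₂))
      fun _ => W.noiseLaw := by
  simpa only [Channel.kernel, law_prodLaw_snd (W.PY3_mem _ _ _).2] using
    (hasCondLaw_outcome_output W P).map fun _ => Prod.snd

/-- The joint law of the inputs `(X₁, X₂, X₃)`. -/
noncomputable def inputLaw (P : ZMod q × ZMod q × ZMod q × 𝒱 → ℝ) :
    ZMod q × ZMod q × ZMod q → ℝ :=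
  law P fun a => (a.1, a.2.1, a.2.2.1)

lemma law_output_prodMk_input (P : ZMod q × ZMod q × ZMod q × 𝒱 → ℝ) :
    law (W.outcomeProb P) (fun o => ((o.Y₃, o.Z₁, o.Z₂), (o.X₁, o.X₂, o.X₃))) =
      fun c => inputLaw P c.2 * W.kernel c.2.1 c.2.2.1 c.2.2.2 c.1 := by
  have hinput : law (W.outcomeProb P) (fun o => (o.X₁, o.X₂, o.X₃)) = inputLaw P := by
    rw [inputLaw, ← law_law (W.outcomeProb P) (fun o => (o.X₁, o.X₂, o.X₃, o.V))
      fun a => (a.1, a.2.1, a.2.2.1), law_outcomeProb_input]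
  have hcond : HasCondLaw (W.outcomeProb P) (fun o => (o.X₁, o.X₂, o.X₃))
      (fun o => (o.Y₃, o.Z₁, o.Z₂)) fun x => W.kernel x.1 x.2.1 x.2.2 :=
    fun G => hasCondLaw_outcome_output W P fun a => G (a.1, a.2.1, a.2.2.1)
  ext c
  rw [hcond.law_prodMk c.1 c.2, hinput]

lemma condMutualInfo_output_congr (h : inputLaw P = inputLaw P') {α β : Type*} [Fintype α]
    [Fintype β] (F : ZMod q × ZMod q × ZMod q → α) (G : ZMod q × ZMod q × ZMod q → β) :
    condMutualInfo (W.outcomeProb P) (fun o => F (o.X₁, o.X₂, o.X₃)) (·.Y₃)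
        (fun o => G (o.X₁, o.X₂, o.X₃)) =
      condMutualInfo (W.outcomeProb P') (fun o => F (o.X₁, o.X₂, o.X₃)) (·.Y₃)
        (fun o => G (o.X₁, o.X₂, o.X₃)) := by
  have hlaw := (law_output_prodMk_input W P).trans (h ▸ (law_output_prodMk_input W P').symm)
  simpa only [condMutualInfo_law] using
    congrArg (fun r => condMutualInfo r (fun c => F c.2) (fun c => c.1.1) fun c => G c.2) hlaw

lemma entropy_output_congr (h : inputLaw P = inputLaw P') {α : Type*} [Fintype α]
    (F : (𝒴 × ZMod q × ZMod q) × ZMod q × ZMod q × ZMod q → α) :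
    entropy (W.outcomeProb P) (fun o => F ((o.Y₃, o.Z₁, o.Z₂), (o.X₁, o.X₂, o.X₃))) =
      entropy (W.outcomeProb P') fun o => F ((o.Y₃, o.Z₁, o.Z₂), (o.X₁, o.X₂, o.X₃)) := by
  have hlaw := (law_output_prodMk_input W P).trans (h ▸ (law_output_prodMk_input W P').symm)
  simpa only [entropy_law] using congrArg (fun r => entropy r F) hlaw

lemma condMutualInfo_input_noisy (hP : P ∈ stdSimplex ℝ (ZMod q × ZMod q × ZMod q × 𝒱)) :
    condMutualInfo (W.outcomeProb P) (·.X₃) (fun o => o.X₃ + o.Z₁) (·.V) =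
      condEntropy (W.outcomeProb P) (fun o => o.X₃ + o.Z₁) (·.V) - entropy W.noiseLaw Prod.fst := by
  rw [condMutualInfo_eq, ← (hasCondLaw_outcome_noise W P).condEntropy_comp_eq
    (outcomeProb_mem_stdSimplex W hP) Prod.fst fun a => a.2.2]
  congr 1
  exact condEntropy_congr (fun _ _ => Iff.rfl) fun o o' h => by simp [(Prod.mk.inj h).1]

lemma rateRegion_subset (hP : P ∈ stdSimplex ℝ (ZMod q × ZMod q × ZMod q × 𝒱))
    (hP' : P' ∈ stdSimplex ℝ (ZMod q × ZMod q × ZMod q × 𝒱')) (h : inputLaw P = inputLaw P')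
    (h₁ : condEntropy (W.outcomeProb P) (fun o => o.X₃ + o.Z₁) (·.V) ≤
      condEntropy (W.outcomeProb P') (fun o => o.X₃ + o.Z₁) (·.V))
    (h₂ : condEntropy (W.outcomeProb P') (fun o => o.X₃ + o.Z₁ + o.Z₂) (·.V) ≤
      condEntropy (W.outcomeProb P) (fun o => o.X₃ + o.Z₁ + o.Z₂) (·.V)) :
    rateRegion W P ⊆ rateRegion W P' := by
  rintro ⟨R₁₃, R₂₃, R₃₁, R₃₂⟩ ⟨p₁₃, p₂₃, p₃₁, p₃₂, b₁₃, b₂₃, b₁₂, b₃₁, b₃₂⟩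
  refine ⟨p₁₃, p₂₃, p₃₁, p₃₂, b₁₃.trans_eq ?_, b₂₃.trans_eq ?_, b₁₂.trans_eq ?_, b₃₁.trans ?_,
    b₃₂.trans ?_⟩
  · exact condMutualInfo_output_congr W h (fun x => x.1) fun x => (x.2.1, x.2.2)
  · exact condMutualInfo_output_congr W h (fun x => x.2.1) fun x => (x.1, x.2.2)
  · exact condMutualInfo_output_congr W h (fun x => (x.1, x.2.1)) fun x => x.2.2
  · rw [condMutualInfo_input_noisy W hP, condMutualInfo_input_noisy W hP']
    exact sub_le_sub_right h₁ _
  · rw [mutualInfo_eq, mutualInfo_eq,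
      entropy_output_congr W h fun c => c.2.2.2 + c.1.2.1 + c.1.2.2]
    exact sub_le_sub_left h₂ _

/-- The entropy of `X + f (Z₁, Z₂)` when `X` has law `κ` and is independent of the noise. -/
noncomputable def Channel.noisyEntropy (f : ZMod q × ZMod q → ZMod q) (κ : ZMod q → ℝ) : ℝ :=
  entropy (prodLaw κ W.noiseLaw) fun t => t.1 + f t.2

lemma condEntropy_noisy_input (hP : P ∈ stdSimplex ℝ (ZMod q × ZMod q × ZMod q × 𝒱))
    {κ : 𝒱 → ZMod q → ℝ} (h : HasCondLaw P (·.2.2.2) (·.2.2.1) κ)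
    (f : ZMod q × ZMod q → ZMod q) :
    condEntropy (W.outcomeProb P) (fun o => o.X₃ + f (o.Z₁, o.Z₂)) (·.V) =
      ∑ a, P a * W.noisyEntropy f (κ a.2.2.2) := by
  have hcond : HasCondLaw (W.outcomeProb P) (·.V) (fun o => (o.X₃, o.Z₁, o.Z₂))
      fun v => prodLaw (κ v) W.noiseLaw := by
    intro G
    calc ∑ o, W.outcomeProb P o * G o.V (o.X₃, o.Z₁, o.Z₂)
        = ∑ a, P a * ∑ z, W.noiseLaw z * G a.2.2.2 (a.2.2.1, z) := by
          rw [← sum_outcomeProb_mul_input W P]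
          exact hasCondLaw_outcome_noise W P fun a z => G a.2.2.2 (a.2.2.1, z)
      _ = ∑ a, P a * ∑ x, κ a.2.2.2 x * ∑ z, W.noiseLaw z * G a.2.2.2 (x, z) :=
          h fun v x => ∑ z, W.noiseLaw z * G v (x, z)
      _ = _ := by
          rw [← sum_outcomeProb_mul_input W P]
          simp only [prodLaw, Fintype.sum_prod_type (α₁ := ZMod q), mul_sum, mul_assoc]
  rw [← sum_outcomeProb_mul_input W P]
  exact hcond.condEntropy_map_eq (outcomeProb_mem_stdSimplex W hP).1 fun _ t => t.1 + f t.2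

end OutcomeLaw

section Cardinality

variable {q : ℕ} [NeZero q] {𝒴 𝒱 𝒰 : Type*} [Fintype 𝒴] [Fintype 𝒱] [Fintype 𝒰]

/-- The joint law of `(X₁, X₂, X₃, U)` for a Markov chain `U → X₃ → (X₁, X₂)`, where `U` has law
`w`, and `κ` and `η` are the transition probabilities of the two steps. -/
def markovLaw (w : 𝒰 → ℝ) (κ : 𝒰 → ZMod q → ℝ) (η : ZMod q → ZMod q × ZMod q → ℝ)
    (a : ZMod q × ZMod q × ZMod q × 𝒰) : ℝ :=
  w a.2.2.2 * κ a.2.2.2 a.2.2.1 * η a.2.2.1 (a.1, a.2.1)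

variable {w : 𝒰 → ℝ} {κ : 𝒰 → ZMod q → ℝ} {η : ZMod q → ZMod q × ZMod q → ℝ}

lemma sum_markovLaw_mul (w : 𝒰 → ℝ) (κ : 𝒰 → ZMod q → ℝ) (η : ZMod q → ZMod q × ZMod q → ℝ)
    (F : ZMod q × ZMod q × ZMod q × 𝒰 → ℝ) :
    ∑ a, markovLaw w κ η a * F a =
      ∑ u, w u * ∑ x, κ u x * ∑ y, η x y * F (y.1, y.2, x, u) := by
  let e : ZMod q × ZMod q × ZMod q × 𝒰 ≃ 𝒰 × ZMod q × ZMod q × ZMod q :=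
    ⟨fun a => (a.2.2.2, a.2.2.1, a.1, a.2.1), fun b => (b.2.2.1, b.2.2.2, b.2.1, b.1),
      fun _ => rfl, fun _ => rfl⟩
  rw [← e.symm.sum_comp]
  simp only [Fintype.sum_prod_type, mul_sum, markovLaw, mul_assoc]
  rfl

lemma markovLaw_mem_stdSimplex (hw : w ∈ stdSimplex ℝ 𝒰) (hκ : ∀ u, κ u ∈ stdSimplex ℝ (ZMod q))
    (hη : ∀ x, η x ∈ stdSimplex ℝ (ZMod q × ZMod q)) :
    markovLaw w κ η ∈ stdSimplex ℝ (ZMod q × ZMod q × ZMod q × 𝒰) :=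
  ⟨fun _ => mul_nonneg (mul_nonneg (hw.1 _) ((hκ _).1 _)) ((hη _).1 _), by
    simpa [(hη _).2, (hκ _).2, hw.2] using sum_markovLaw_mul w κ η fun _ => 1⟩

lemma hasCondLaw_markovLaw (w : 𝒰 → ℝ) (hκ : ∀ u, ∑ x, κ u x = 1) (hη : ∀ x, ∑ y, η x y = 1) :
    HasCondLaw (markovLaw w κ η) (·.2.2.2) (·.2.2.1) κ := by
  intro G
  rw [sum_markovLaw_mul w κ η fun a => G a.2.2.2 a.2.2.1,
    sum_markovLaw_mul w κ η fun a => ∑ x, κ a.2.2.2 x * G a.2.2.2 x]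
  simp only [← sum_mul, hη, one_mul, hκ]

lemma inputLaw_markovLaw (w : 𝒰 → ℝ) (κ : 𝒰 → ZMod q → ℝ)
    (η : ZMod q → ZMod q × ZMod q → ℝ) (x : ZMod q × ZMod q × ZMod q) :
    inputLaw (markovLaw w κ η) x = (∑ u, w u * κ u x.2.2) * η x.2.2 (x.1, x.2.1) := by
  classical
  let δ : ZMod q × ZMod q × ZMod q → ℝ := Pi.single x 1
  have hsum := (sum_law_mul (markovLaw w κ η) (fun a => (a.1, a.2.1, a.2.2.1)) δ).trans
    (sum_markovLaw_mul w κ η fun a => δ (a.1, a.2.1, a.2.2.1))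
  simpa [δ, inputLaw, Pi.single_apply, Prod.ext_iff, Fintype.sum_prod_type, ite_and,
    sum_ite_irrel, sum_mul, mul_assoc] using hsum

lemma condEntropy_markovLaw (W : Channel q 𝒴) (hw : w ∈ stdSimplex ℝ 𝒰)
    (hκ : ∀ u, κ u ∈ stdSimplex ℝ (ZMod q)) (hη : ∀ x, η x ∈ stdSimplex ℝ (ZMod q × ZMod q))
    (f : ZMod q × ZMod q → ZMod q) :
    condEntropy (W.outcomeProb (markovLaw w κ η)) (fun o => o.X₃ + f (o.Z₁, o.Z₂)) (·.V) =
      ∑ u, w u * W.noisyEntropy f (κ u) := by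
  rw [condEntropy_noisy_input W (markovLaw_mem_stdSimplex hw hκ hη)
    (hasCondLaw_markovLaw w (fun u => (hκ u).2) fun x => (hη x).2),
    sum_markovLaw_mul w κ η fun a => W.noisyEntropy f (κ a.2.2.2)]
  simp only [← sum_mul, (hη _).2, one_mul, (hκ _).2]

lemma inputLaw_eq {P : ZMod q × ZMod q × ZMod q × 𝒱 → ℝ}
    (h : HasCondLaw P (·.2.2.1) (fun a => (a.1, a.2.1)) η) (x : ZMod q × ZMod q × ZMod q) :
    inputLaw P x = law P (·.2.2.1) x.2.2 * η x.2.2 (x.1, x.2.1) := by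
  rw [← h.law_prodMk]
  exact law_congr fun a => by simp only [Prod.ext_iff]; tauto

lemma exists_fin_mixture (W : Channel q 𝒴) {κ : 𝒱 → ZMod q → ℝ}
    (hκ : ∀ v, κ v ∈ stdSimplex ℝ (ZMod q)) {p : 𝒱 → ℝ} (hp : p ∈ stdSimplex ℝ 𝒱)
    (f g : ZMod q × ZMod q → ZMod q) :
    ∃ k ≤ q + 1, ∃ u : Fin k → 𝒱, ∃ w ∈ stdSimplex ℝ (Fin k),
      (∀ x, ∑ j, w j * κ (u j) x = ∑ v, p v * κ v x) ∧
      ∑ j, w j * W.noisyEntropy f (κ (u j)) = ∑ v, p v * W.noisyEntropy f (κ v) ∧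
      ∑ j, w j * W.noisyEntropy g (κ (u j)) ≤ ∑ v, p v * W.noisyEntropy g (κ v) := by
  let total : (ZMod q → ℝ) × ℝ →ₗ[ℝ] ℝ := (∑ x, LinearMap.proj x) ∘ₗ LinearMap.fst ℝ _ _
  have htotal : ∀ r, total r = ∑ x, r.1 x := fun r => by simp [total]
  obtain ⟨k, hk, u, w, hw, hwA, hwg⟩ := exists_fin_conic_combination
    (A := fun v => (κ v, W.noisyEntropy f (κ v))) total
    (fun v => by simp [htotal, (hκ v).2]) (fun v => W.noisyEntropy g (κ v)) hp.1
  have hmix : ∀ x, ∑ j, w j * κ (u j) x = ∑ v, p v * κ v x := fun x => by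
    simpa [Prod.fst_sum] using congrFun (congrArg Prod.fst hwA) x
  have hsum : ∑ j, w j = 1 :=
    calc ∑ j, w j = ∑ x, ∑ j, w j * κ (u j) x := by
          rw [sum_comm]
          simp only [← mul_sum, (hκ _).2, mul_one]
      _ = ∑ x, ∑ v, p v * κ v x := sum_congr rfl fun x _ => hmix x
      _ = 1 := by
          rw [sum_comm]
          simp only [← mul_sum, (hκ _).2, mul_one, hp.2]
  exact ⟨k, by simpa using hk, u, w, ⟨hw, hsum⟩, hmix,
    by simpa [Prod.snd_sum] using congrArg Prod.snd hwA, hwg⟩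

lemma exists_rateRegion_subset (W : Channel q 𝒴) {P : ZMod q × ZMod q × ZMod q × 𝒱 → ℝ}
    (hP : P ∈ stdSimplex ℝ (ZMod q × ZMod q × ZMod q × 𝒱)) :
    ∃ k ≤ q + 1, ∃ P' ∈ stdSimplex ℝ (ZMod q × ZMod q × ZMod q × Fin k),
      rateRegion W P ⊆ rateRegion W P' := by
  obtain ⟨κ, hκ, hκP⟩ := exists_hasCondLaw hP (·.2.2.2) (·.2.2.1)
  obtain ⟨η, hη, hηP⟩ := exists_hasCondLaw hP (·.2.2.1) fun a => (a.1, a.2.1)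
  obtain ⟨k, hk, u, w, hw, hX, hH₁, hH₂⟩ := exists_fin_mixture W hκ
    (law_mem_stdSimplex hP (·.2.2.2)) Prod.fst fun z => z.1 + z.2
  have hcond : ∀ f, condEntropy (W.outcomeProb P) (fun o => o.X₃ + f (o.Z₁, o.Z₂)) (·.V) =
      ∑ v, law P (·.2.2.2) v * W.noisyEntropy f (κ v) := fun f => by
    rw [condEntropy_noisy_input W hP hκP, sum_law_mul P _ fun v => W.noisyEntropy f (κ v)]
  have hcond' := condEntropy_markovLaw W hw (fun j => hκ (u j)) hη
  have hP' := markovLaw_mem_stdSimplex hw (fun j => hκ (u j)) hη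
  refine ⟨k, hk, _, hP', rateRegion_subset W hP hP' ?_ ?_ ?_⟩
  · ext x
    rw [inputLaw_eq hηP, inputLaw_markovLaw, hX, hκP.law_eq_sum]
  · exact ((hcond Prod.fst).trans (hH₁.symm.trans (hcond' Prod.fst).symm)).le
  · simpa only [add_assoc] using
      (hcond' fun z => z.1 + z.2).trans_le (hH₂.trans_eq (hcond _).symm)

end Cardinality

section Limit

variable {q : ℕ} [NeZero q] {𝒴 : Type*} [Fintype 𝒴] {n : ℕ} {R R₁₃ R₂₃ R₃₁ R₃₂ : ℝ}

lemma card_msg_pos (hR : 0 ≤ R) : 0 < Fintype.card (Msg n R) := by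
  rw [Fintype.card_fin]
  exact Nat.floor_pos.2 (one_le_rpow one_le_two (by positivity))

lemma le_logb_card_msg (hR : 0 ≤ R) : n * R - 1 ≤ logb 2 (Fintype.card (Msg n R)) := by
  have hpos : (1 : ℝ) ≤ Fintype.card (Msg n R) := by exact_mod_cast card_msg_pos hR
  have hfloor : (2 : ℝ) ^ (n * R) ≤ 2 * Fintype.card (Msg n R) := by
    have := Nat.lt_floor_add_one ((2 : ℝ) ^ (n * R))
    rw [Fintype.card_fin] at hpos ⊢
    linarith
  have hlog := logb_le_logb_of_le one_lt_two (by positivity) hfloor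
  rw [logb_rpow two_pos (by norm_num), logb_mul two_ne_zero (by positivity),
    logb_self_eq_one one_lt_two] at hlog
  linarith

lemma le_logb_card_msg_prod {R' : ℝ} (hR : 0 ≤ R) (hR' : 0 ≤ R') :
    n * (R + R') - 2 ≤ logb 2 (Fintype.card (Msg n R × Msg n R')) := by
  rw [Fintype.card_prod, Nat.cast_mul, logb_mul (by exact_mod_cast (card_msg_pos hR).ne')
    (by exact_mod_cast (card_msg_pos hR').ne')]
  linarith [le_logb_card_msg (n := n) hR, le_logb_card_msg (n := n) hR']

lemma nonempty_messages (h₁₃ : 0 ≤ R₁₃) (h₂₃ : 0 ≤ R₂₃) (h₃₁ : 0 ≤ R₃₁) (h₃₂ : 0 ≤ R₃₂) :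
    Nonempty (Messages n R₁₃ R₂₃ R₃₁ R₃₂) :=
  ⟨⟨⟨0, by simpa using card_msg_pos h₁₃⟩, ⟨0, by simpa using card_msg_pos h₂₃⟩,
    ⟨0, by simpa using card_msg_pos h₃₁⟩, ⟨0, by simpa using card_msg_pos h₃₂⟩⟩⟩

lemma errorProb_nonneg (W : Channel q 𝒴) (c : Code q 𝒴 n R₁₃ R₂₃ R₃₁ R₃₂) :
    0 ≤ errorProb W c :=
  (prob_nonneg (sampleProb_nonneg W c) _).trans_eq (errorProb_eq_prob W c).symm

lemma errorProb_le_one [Nonempty (Messages n R₁₃ R₂₃ R₃₁ R₃₂)] (W : Channel q 𝒴)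
    (c : Code q 𝒴 n R₁₃ R₂₃ R₃₁ R₃₂) : errorProb W c ≤ 1 :=
  (errorProb_eq_prob W c).trans_le (prob_le_one (sampleProb_mem_stdSimplex W c) _)

/-- A bound on how far the rates of a code can exceed the single-letter mutual informations. -/
noncomputable def rateLoss (W : Channel q 𝒴) (c : Code q 𝒴 n R₁₃ R₂₃ R₃₁ R₃₂) : ℝ :=
  errorProb W c * (R₁₃ + R₂₃ + R₃₁ + R₃₂) + 3 / n

lemma sub_rateLoss_le [NeZero n] [Nonempty (Messages n R₁₃ R₂₃ R₃₁ R₃₂)] (W : Channel q 𝒴)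
    (c : Code q 𝒴 n R₁₃ R₂₃ R₃₁ R₃₂) {L I : ℝ} (hR : R ≤ R₁₃ + R₂₃ + R₃₁ + R₃₂)
    (hL : n * R - 2 ≤ L) (hI : (1 - errorProb W c) * L - 1 ≤ n * I) :
    R - rateLoss W c ≤ I := by
  have hn : (0 : ℝ) < n := by exact_mod_cast NeZero.pos n
  have hscaled : n * (R - errorProb W c * R) - 3 ≤ n * I := by
    linarith [mul_le_mul_of_nonneg_left hL (sub_nonneg.2 (errorProb_le_one W c)),
      errorProb_nonneg W c]
  have hdiv : R - errorProb W c * R - 3 / n ≤ I := by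
    rwa [← mul_le_mul_iff_right₀ hn, mul_sub, mul_div_cancel₀ _ hn.ne']
  rw [rateLoss]
  linarith [mul_le_mul_of_nonneg_left hR (errorProb_nonneg W c)]

lemma rateLoss_nonneg (W : Channel q 𝒴) (c : Code q 𝒴 n R₁₃ R₂₃ R₃₁ R₃₂)
    (hR : 0 ≤ R₁₃ + R₂₃ + R₃₁ + R₃₂) : 0 ≤ rateLoss W c :=
  add_nonneg (mul_nonneg (errorProb_nonneg W c) hR) (by positivity)

lemma exists_mem_rateRegion [NeZero n] (W : Channel q 𝒴) (c : Code q 𝒴 n R₁₃ R₂₃ R₃₁ R₃₂)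
    (h₁₃ : 0 ≤ R₁₃) (h₂₃ : 0 ≤ R₂₃) (h₃₁ : 0 ≤ R₃₁) (h₃₂ : 0 ≤ R₃₂) :
    ∃ k ≤ q + 1, ∃ P ∈ stdSimplex ℝ (ZMod q × ZMod q × ZMod q × Fin k),
      (max (R₁₃ - rateLoss W c) 0, max (R₂₃ - rateLoss W c) 0, max (R₃₁ - rateLoss W c) 0,
        max (R₃₂ - rateLoss W c) 0) ∈ rateRegion W P := by
  have := nonempty_messages (n := n) h₁₃ h₂₃ h₃₁ h₃₂
  have hP := inputAuxLaw_mem_stdSimplex W c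
  have hμ := outcomeProb_mem_stdSimplex W hP
  have hloss := rateLoss_nonneg W c (by positivity)
  have hcard {R : ℝ} (hR : 0 ≤ R) : n * R - 2 ≤ logb 2 (Fintype.card (Msg n R)) :=
    (sub_le_sub_left one_le_two _).trans (le_logb_card_msg hR)
  have b₁₃ := sub_rateLoss_le W c (by linarith) (hcard h₁₃) (mac_single_letter₁ W c)
  have b₂₃ := sub_rateLoss_le W c (by linarith) (hcard h₂₃) (mac_single_letter₂ W c)
  have b₁₂ := sub_rateLoss_le W c (by linarith) (le_logb_card_msg_prod h₁₃ h₂₃)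
    (mac_single_letter₁₂ W c)
  have b₃₁ := sub_rateLoss_le W c (by linarith) (hcard h₃₁) (broadcast_single_letter₁ W c)
  have b₃₂ := sub_rateLoss_le W c (by linarith) (hcard h₃₂) (broadcast_single_letter₂ W c)
  have hI₁₂ := condMutualInfo_nonneg hμ.1 (fun o => (o.X₁, o.X₂)) (·.Y₃) (·.X₃)
  obtain ⟨k, hk, P, hkP, hsub⟩ := exists_rateRegion_subset W hP
  refine ⟨k, hk, P, hkP, hsub ⟨le_max_right _ _, le_max_right _ _, le_max_right _ _,
    le_max_right _ _, max_le b₁₃ (condMutualInfo_nonneg hμ.1 _ _ _),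
    max_le b₂₃ (condMutualInfo_nonneg hμ.1 _ _ _), ?_,
    max_le b₃₁ (condMutualInfo_nonneg hμ.1 _ _ _), max_le b₃₂ (mutualInfo_nonneg hμ _ _)⟩⟩
  rw [← max_add_add_right, ← max_add_add_left, ← max_add_add_left]
  refine max_le (max_le ?_ ?_) (max_le ?_ ?_) <;> linarith

lemma tendsto_rateLoss (W : Channel q 𝒴) {c : (n : ℕ) → Code q 𝒴 n R₁₃ R₂₃ R₃₁ R₃₂}
    (hc : Filter.Tendsto (fun n => errorProb W (c n)) Filter.atTop (nhds 0)) :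
    Filter.Tendsto (fun n => rateLoss W (c n)) Filter.atTop (nhds 0) := by
  simpa [rateLoss] using (hc.mul_const (R₁₃ + R₂₃ + R₃₁ + R₃₂)).add
    (tendsto_const_div_atTop_nhds_zero_nat (3 : ℝ))

end Limit

end MADB

theorem theorem12_general {q : ℕ} [NeZero q] {𝒴 : Type*} [Fintype 𝒴]
    (W : MADB.Channel q 𝒴) (R₁₃ R₂₃ R₃₁ R₃₂ : ℝ)
    (hR : MADB.Achievable W R₁₃ R₂₃ R₃₁ R₃₂) :
    (R₁₃, R₂₃, R₃₁, R₃₂) ∈ closure {R | ∃ k ≤ q + 1,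
      ∃ P ∈ stdSimplex ℝ (ZMod q × ZMod q × ZMod q × Fin k), R ∈ MADB.rateRegion W P} := by
  obtain ⟨h₁₃, h₂₃, h₃₁, h₃₂, c, hc⟩ := hR
  have hlim {R : ℝ} (h : 0 ≤ R) : Filter.Tendsto
      (fun n => max (R - MADB.rateLoss W (c n)) 0) Filter.atTop (nhds R) := by
    simpa [h] using ((MADB.tendsto_rateLoss W hc).const_sub R).max (tendsto_const_nhds (x := 0))
  refine mem_closure_of_tendsto ((hlim h₁₃).prodMk_nhds ((hlim h₂₃).prodMk_nhds
    ((hlim h₃₁).prodMk_nhds (hlim h₃₂)))) ?_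
  filter_upwards [Filter.eventually_ne_atTop 0] with n hn
  have : NeZero n := ⟨hn⟩
  exact MADB.exists_mem_rateRegion W (c n) h₁₃ h₂₃ h₃₁ h₃₂

theorem theorem12 {q : ℕ} [NeZero q] (hq : 2 ≤ q) {𝒴 : Type*} [Fintype 𝒴]
    (W : MADB.Channel q 𝒴) (R₁₃ R₂₃ R₃₁ R₃₂ : ℝ)
    (hR : MADB.Achievable W R₁₃ R₂₃ R₃₁ R₃₂) :
    (R₁₃, R₂₃, R₃₁, R₃₂) ∈ MADB.outerBound W :=
  closure_mono (subset_convexHull ℝ _) (theorem12_general W R₁₃ R₂₃ R₃₁ R₃₂ hR)
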